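/- **Setting.** Let $S$ be any commutative semiring. Fix a countably infinite set of variables. Resource terms $s$ and resource monomials $\bar t$ are given by $s ::= x \mid \lambda x\,s \mid \langle s\rangle\,\bar t$ and $\bar t ::= [\,] \mid [s]\cdot\bar t$, terms being taken up to $\alpha$-equivalence and monomials up to permutation (so monomials are finite multisets of terms). Let $\Delta$ denote either the set of resource terms or the set of resource monomials (the same choice throughout). The height is $h(x)=1$, $h(\lambda x\,s)=1+h(s)$, $h(\langle s\rangle\,\bar t)=\max(h(s),1+h(\bar t))$, $h([s_1,\dots,s_n])=\max_i h(s_i)$ (and $0$ if $n=0$). Finite sums of expressions are elements of $\mathbb N[\Delta]$ (finitely supported $\mathbb N$-valued vectors), and all constructions are extended to them by (multi)linearity. The partial derivative $\frac{\partial e}{\partial x}\cdot u$ of an expression along a term $u$ is the sum, over the free occurrences of $x$ in $e$, of the (capture-avoiding) replacement of that occurrence by $u$. For $\bar t=[t_1,\dots,t_n]$ with $x$ not free in the $t_i$, the multilinear substitution $\partial_x e\cdot\bar t\in\mathbb N[\Delta]$ is obtained by differentiating $e$ with respect to $x$ successively along $t_1,\dots,t_n$, and then discarding the summands in which $x$ is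 still free. Parallel reduction $\rightrightarrows\ \subseteq \Delta\times\mathbb N[\Delta]$ is defined inductively: $x\rightrightarrows x$; $\lambda x\,s\rightrightarrows\lambda x\,\sigma'$, $\langle s\rangle\,\bar t\rightrightarrows\langle\sigma'\rangle\,\bar\tau'$ and $\langle\lambda x\,s\rangle\,\bar t\rightrightarrows\partial_x\sigma'\cdot\bar\tau'$ whenever $s\rightrightarrows\sigma'$ and $\bar t\rightrightarrows\bar\tau'$; and $[s_1,\dots,s_n]\rightrightarrows[\sigma'_1,\dots,\sigma'_n]$ whenever $s_i\rightrightarrows\sigma'_i$ for all $i$. The full parallel reduct $F(e)\in\mathbb N[\Delta]$ is given by $F(x)=x$, $F(\lambda x\,s)=\lambda x\,F(s)$, $F(\langle\lambda x\,s\rangle\,\bar t)=\partial_xF(s)\cdot F(\bar t)$, $F(\langle s\rangle\,\bar t)=\langle F(s)\rangle\,F(\bar t)$ if $s$ is not an abstraction, and $F([s_1,\dots,s_n])=[F(s_1),\dots,F(s_n)]$. A resource vector is a family $\varepsilon=(\varepsilon_e)_{e\in\Delta}\in S^\Delta$ whose support $|\varepsilon|=\{e : \varepsilon_e\ne 0\}$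 has finitely many free variables in total; it is bounded if $\{h(e): e\in|\varepsilon|\}$ is finite. A family of vectors is summable if each coordinate is nonzero for only finitely many members of the family; its sum is then taken pointwise. Finite sums are viewed as vectors through the semiring morphism $\mathbb N\to S$. When $(F(e))_{e\in|\varepsilon|}$ is summable, put $F(\varepsilon)=\sum_{e\in|\varepsilon|}\varepsilon_e\,F(e)$. A resource structure is a set $\mathfrak E$ of subsets of $\Delta$, each with finitely many free variables in total, that contains all finite subsets of $\Delta$ and is closed under finite unions and under subsets. For a resource structure $\mathfrak E$ and resource vectors $\varepsilon,\varepsilon'$, write $\varepsilon\Rightarrow_{\mathfrak E}\varepsilon'$ if there are $\mathcal E\in\mathfrak E$, a set $I$, and families $(a_i)_{i\in I}$ in $S$, $(e_i)_{i\in I}$ in $\mathcal E$ and $(\varepsilon'_i)_{i\in I}$ in $\mathbb N[\Delta]$ such that $(e_i)_{i\in I}$ and $(\varepsilon'_i)_{i\in I}$ are summable, $\varepsilon=\sum_i a_i e_i$, $\varepsilon'=\sum_i a_i\varepsilon'_i$, and $e_i\rightrightarrows\varepsilon'_i$ for all $i\in I$. A bounded reduction structure is a resource structure $\mathfrak E$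 such that every $\mathcal E\in\mathfrak E$ has bounded height and $\bigcup\{|\varphi| : e\in\mathcal E,\ e\rightrightarrows\varphi\}\in\mathfrak E$ for every $\mathcal E\in\mathfrak E$. **Statement.** Let $\mathfrak E$ be any bounded reduction structure. 1. If $\varepsilon\Rightarrow_{\mathfrak E}\varepsilon'$, then $\varepsilon$ is bounded, the family $(F(e))_{e\in|\varepsilon|}$ is summable (so that $F(\varepsilon)$ is well defined), and $\varepsilon'\Rightarrow_{\mathfrak E}F(\varepsilon)$. 2. Hence $\Rightarrow_{\mathfrak E}$ is strongly confluent: if $\varepsilon\Rightarrow_{\mathfrak E}\varepsilon_1$ and $\varepsilon\Rightarrow_{\mathfrak E}\varepsilon_2$, then there is $\varepsilon''$ with $\varepsilon_1\Rightarrow_{\mathfrak E}\varepsilon''$ and $\varepsilon_2\Rightarrow_{\mathfrak E}\varepsilon''$. Moreover, the set $\mathfrak B$ of all subsets of $\Delta$ of bounded height and with finitely many free variables is itself a bounded reduction structure; so 1 and 2 apply to $\Rightarrow_{\mathfrak B}$, the reduction of resource vectors of bounded height. No hypothesis on $S$ is needed beyond its being a commutative semiring. -/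

import Mathlib

namespace ResourceCalculus

/-! ### Resource expressions -/

/-- The two sorts of resource expressions: terms and monomials. -/
inductive Kind : Type
  | tm
  | mon

/-- Raw resource expressions, in de Bruijn notation: α-equivalence is syntactic equality.
The variables are the natural numbers. `lam s` binds the variable `0` of `s`, and the variable
`n + 1` of `s` is the variable `n` of `lam s`. A raw monomial is a list of terms. -/
inductive Raw : Kind → Type
  | var : ℕ → Raw Kind.tm
  | lam : Raw Kind.tm → Raw Kind.tm
  | app : Raw Kind.tm → Raw Kind.mon → Raw Kind.tm
  | nil : Raw Kind.mon
  | cons : Raw Kind.tm → Raw Kind.mon → Raw Kind.mon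

/-- The congruence generated by permuting the elements of monomials. -/
inductive Raw.Equiv : {κ : Kind} → Raw κ → Raw κ → Prop
  | refl {κ : Kind} (e : Raw κ) : Raw.Equiv e e
  | symm {κ : Kind} {e f : Raw κ} : Raw.Equiv e f → Raw.Equiv f e
  | trans {κ : Kind} {e f g : Raw κ} : Raw.Equiv e f → Raw.Equiv f g → Raw.Equiv e g
  | lam {s s' : Raw Kind.tm} : Raw.Equiv s s' → Raw.Equiv (Raw.lam s) (Raw.lam s')
  | app {s s' : Raw Kind.tm} {t t' : Raw Kind.mon} :
      Raw.Equiv s s' → Raw.Equiv t t' → Raw.Equiv (Raw.app s t) (Raw.app s' t')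
  | cons {s s' : Raw Kind.tm} {t t' : Raw Kind.mon} :
      Raw.Equiv s s' → Raw.Equiv t t' → Raw.Equiv (Raw.cons s t) (Raw.cons s' t')
  | swap (a b : Raw Kind.tm) (t : Raw Kind.mon) :
      Raw.Equiv (Raw.cons a (Raw.cons b t)) (Raw.cons b (Raw.cons a t))

instance Raw.setoid (κ : Kind) : Setoid (Raw κ) :=
  ⟨Raw.Equiv, Raw.Equiv.refl, Raw.Equiv.symm, Raw.Equiv.trans⟩

/-- Resource expressions: `Expr Kind.tm` is the set of resource terms, `Expr Kind.mon` the set of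
resource monomials, that is, of finite multisets of resource terms. -/
def Expr (κ : Kind) : Type := Quotient (Raw.setoid κ)

def Expr.mk {κ : Kind} (e : Raw κ) : Expr κ := Quotient.mk (Raw.setoid κ) e

theorem Expr.mk_eq {κ : Kind} {e f : Raw κ} (h : Raw.Equiv e f) : Expr.mk e = Expr.mk f :=
  Quotient.sound (s := Raw.setoid κ) h

theorem Expr.mk_surj {κ : Kind} (e : Expr κ) : ∃ r : Raw κ, Expr.mk r = e :=
  Quotient.exists_rep e

/-- The variable `n`. -/
def Expr.var (n : ℕ) : Expr Kind.tm := Expr.mk (Raw.var n)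

/-- Abstraction (over the variable `0`). -/
def Expr.lam (s : Expr Kind.tm) : Expr Kind.tm :=
  Quotient.liftOn s (fun s => Expr.mk (Raw.lam s)) fun _ _ h => Expr.mk_eq (Raw.Equiv.lam h)

/-- Application of a resource term to a resource monomial. -/
def Expr.app (s : Expr Kind.tm) (t : Expr Kind.mon) : Expr Kind.tm :=
  Quotient.liftOn₂ s t (fun s t => Expr.mk (Raw.app s t))
    fun _ _ _ _ h k => Expr.mk_eq (Raw.Equiv.app h k)

/-- The empty monomial. -/
def Expr.nil : Expr Kind.mon := Expr.mk Raw.nil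

/-- Addition of a term to a monomial. -/
def Expr.cons (s : Expr Kind.tm) (t : Expr Kind.mon) : Expr Kind.mon :=
  Quotient.liftOn₂ s t (fun s t => Expr.mk (Raw.cons s t))
    fun _ _ _ _ h k => Expr.mk_eq (Raw.Equiv.cons h k)

theorem Expr.cons_swap (a b : Expr Kind.tm) (t : Expr Kind.mon) :
    Expr.cons a (Expr.cons b t) = Expr.cons b (Expr.cons a t) := by
  obtain ⟨a, rfl⟩ := a.mk_surj
  obtain ⟨b, rfl⟩ := b.mk_surj
  obtain ⟨t, rfl⟩ := t.mk_surj
  exact Expr.mk_eq (Raw.Equiv.swap a b t)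

/-- The terms in a raw monomial. -/
def Raw.elems : {κ : Kind} → Raw κ → Multiset (Expr Kind.tm)
  | _, Raw.nil => 0
  | _, Raw.cons s t => Expr.mk s ::ₘ t.elems
  | _, _ => 0

theorem Raw.elems_congr {κ : Kind} {e f : Raw κ} (h : Raw.Equiv e f) : e.elems = f.elems := by
  induction h with
  | refl e => rfl
  | symm _ ih => exact ih.symm
  | trans _ _ ih₁ ih₂ => exact ih₁.trans ih₂
  | lam _ _ => simp [Raw.elems]
  | app _ _ _ _ => simp [Raw.elems]
  | cons hs _ _ iht => simp [Raw.elems, iht, Expr.mk_eq hs]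
  | swap a b t => simp [Raw.elems, Multiset.cons_swap]

/-- The multiset of the terms in a monomial. -/
def Expr.elems (t : Expr Kind.mon) : Multiset (Expr Kind.tm) :=
  Quotient.liftOn t Raw.elems fun _ _ h => Raw.elems_congr h

/-- The free variables of a raw expression. -/
def Raw.fv : {κ : Kind} → Raw κ → Set ℕ
  | _, Raw.var n => {n}
  | _, Raw.lam s => {n | n + 1 ∈ s.fv}
  | _, Raw.app s t => s.fv ∪ t.fv
  | _, Raw.nil => ∅
  | _, Raw.cons s t => s.fv ∪ t.fv

theorem Raw.fv_congr {κ : Kind} {e f : Raw κ} (h : Raw.Equiv e f) : e.fv = f.fv := by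
  induction h with
  | refl e => rfl
  | symm _ ih => exact ih.symm
  | trans _ _ ih₁ ih₂ => exact ih₁.trans ih₂
  | lam _ ih => simp [Raw.fv, ih]
  | app _ _ ih₁ ih₂ => simp [Raw.fv, ih₁, ih₂]
  | cons _ _ ih₁ ih₂ => simp [Raw.fv, ih₁, ih₂]
  | swap a b t => simp [Raw.fv, Set.union_left_comm]

/-- The set of free variables of an expression. -/
def Expr.fv {κ : Kind} (e : Expr κ) : Set ℕ :=
  Quotient.liftOn e Raw.fv fun _ _ h => Raw.fv_congr h

/-- The height of a raw expression. -/
def Raw.height : {κ : Kind} → Raw κ → ℕ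
  | _, Raw.var _ => 1
  | _, Raw.lam s => 1 + s.height
  | _, Raw.app s t => max s.height (1 + t.height)
  | _, Raw.nil => 0
  | _, Raw.cons s t => max s.height t.height

theorem Raw.height_congr {κ : Kind} {e f : Raw κ} (h : Raw.Equiv e f) :
    e.height = f.height := by
  induction h with
  | refl e => rfl
  | symm _ ih => exact ih.symm
  | trans _ _ ih₁ ih₂ => exact ih₁.trans ih₂
  | lam _ ih => simp [Raw.height, ih]
  | app _ _ ih₁ ih₂ => simp [Raw.height, ih₁, ih₂]
  | cons _ _ ih₁ ih₂ => simp [Raw.height, ih₁, ih₂]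
  | swap a b t => simp [Raw.height, max_left_comm]

/-- The height of an expression; in an application, the function does not get deeper. -/
def Expr.height {κ : Kind} (e : Expr κ) : ℕ :=
  Quotient.liftOn e Raw.height fun _ _ h => Raw.height_congr h

/-! ### Renaming of free variables -/

/-- The renaming `f` below a binder. -/
def liftRen (f : ℕ → ℕ) : ℕ → ℕ
  | 0 => 0
  | n + 1 => f n + 1

/-- Renaming of the free variables of a raw expression along `f`. -/
def Raw.rename : {κ : Kind} → (ℕ → ℕ) → Raw κ → Raw κ
  | _, f, Raw.var n => Raw.var (f n)
  | _, f, Raw.lam s => Raw.lam (s.rename (liftRen f))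
  | _, f, Raw.app s t => Raw.app (s.rename f) (t.rename f)
  | _, _, Raw.nil => Raw.nil
  | _, f, Raw.cons s t => Raw.cons (s.rename f) (t.rename f)

theorem Raw.rename_congr {κ : Kind} {e e' : Raw κ} (h : Raw.Equiv e e') :
    ∀ f : ℕ → ℕ, Raw.Equiv (e.rename f) (e'.rename f) := by
  induction h with
  | refl e => exact fun _ => Raw.Equiv.refl _
  | symm _ ih => exact fun f => (ih f).symm
  | trans _ _ ih₁ ih₂ => exact fun f => (ih₁ f).trans (ih₂ f)
  | lam _ ih => exact fun f => (ih _).lam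
  | app _ _ ih₁ ih₂ => exact fun f => (ih₁ f).app (ih₂ f)
  | cons _ _ ih₁ ih₂ => exact fun f => (ih₁ f).cons (ih₂ f)
  | swap a b t => exact fun f => Raw.Equiv.swap _ _ _

/-- Capture-avoiding renaming of the free variables of an expression along `f`. -/
def Expr.rename {κ : Kind} (f : ℕ → ℕ) (e : Expr κ) : Expr κ :=
  Quotient.liftOn e (fun e => Expr.mk (e.rename f))
    fun _ _ h => Expr.mk_eq (Raw.rename_congr h f)

/-- Move an expression under one more binder, so that the variable `0` becomes fresh. -/
def Expr.shift {κ : Kind} (e : Expr κ) : Expr κ := e.rename Nat.succ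

/-- Move an expression in which the variable `0` is not free out of one binder. -/
def Expr.unshift {κ : Kind} (e : Expr κ) : Expr κ := e.rename Nat.pred

/-! ### Finite sums of expressions

A finite sum of resource expressions (a finitely supported vector with coefficients in `ℕ`) is a
multiset of resource expressions: `0` is the empty sum, `+` the sum, `{e}` the sum reduced to
`e`. All constructions are extended to finite sums by (multi)linearity. -/

def lamSum (σ : Multiset (Expr Kind.tm)) : Multiset (Expr Kind.tm) := σ.map Expr.lam

def appSum (σ : Multiset (Expr Kind.tm)) (τ : Multiset (Expr Kind.mon)) :
    Multiset (Expr Kind.tm) :=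
  σ.bind fun s => τ.map fun t => Expr.app s t

def consSum (σ : Multiset (Expr Kind.tm)) (τ : Multiset (Expr Kind.mon)) :
    Multiset (Expr Kind.mon) :=
  σ.bind fun s => τ.map fun t => Expr.cons s t

theorem consSum_swap (α β : Multiset (Expr Kind.tm)) (τ : Multiset (Expr Kind.mon)) :
    consSum α (consSum β τ) = consSum β (consSum α τ) := by
  simp only [consSum, Multiset.map_bind, Multiset.map_map, Function.comp_def]
  rw [Multiset.bind_bind]
  simp only [Expr.cons_swap]

/-! ### Partial derivatives and multilinear substitution -/

/-- The partial derivative of a raw expression. -/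
def Raw.pdiff : {κ : Kind} → ℕ → Expr Kind.tm → Raw κ → Multiset (Expr κ)
  | _, x, u, Raw.var y => if y = x then {u} else 0
  | _, x, u, Raw.lam s => lamSum (s.pdiff (x + 1) u.shift)
  | _, x, u, Raw.app s t => appSum (s.pdiff x u) {Expr.mk t} + appSum {Expr.mk s} (t.pdiff x u)
  | _, _, _, Raw.nil => 0
  | _, x, u, Raw.cons s t => consSum (s.pdiff x u) {Expr.mk t} + consSum {Expr.mk s} (t.pdiff x u)

theorem Raw.pdiff_congr {κ : Kind} {e f : Raw κ} (h : Raw.Equiv e f) :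
    ∀ (x : ℕ) (u : Expr Kind.tm), e.pdiff x u = f.pdiff x u := by
  induction h with
  | refl e => exact fun _ _ => rfl
  | symm _ ih => exact fun x u => (ih x u).symm
  | trans _ _ ih₁ ih₂ => exact fun x u => (ih₁ x u).trans (ih₂ x u)
  | lam _ ih => exact fun x u => by simp [Raw.pdiff, ih]
  | app h₁ h₂ ih₁ ih₂ =>
    exact fun x u => by simp only [Raw.pdiff, ih₁, ih₂, Expr.mk_eq h₁, Expr.mk_eq h₂]
  | cons h₁ h₂ ih₁ ih₂ =>
    exact fun x u => by simp only [Raw.pdiff, ih₁, ih₂, Expr.mk_eq h₁, Expr.mk_eq h₂]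
  | swap a b t =>
    intro x u
    have key : ∀ c : Raw Kind.tm,
        ({Expr.mk (Raw.cons c t)} : Multiset (Expr Kind.mon))
          = consSum {Expr.mk c} {Expr.mk t} := by
      intro c
      simp only [consSum, Multiset.singleton_bind, Multiset.map_singleton]
      rfl
    have hadd : ∀ (α : Multiset (Expr Kind.tm)) (β γ : Multiset (Expr Kind.mon)),
        consSum α (β + γ) = consSum α β + consSum α γ := by
      intro α β γ
      simp [consSum]
    simp only [Raw.pdiff, key, hadd]
    rw [consSum_swap (Raw.pdiff x u a), consSum_swap {Expr.mk a} (Raw.pdiff x u b),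
      consSum_swap {Expr.mk a} {Expr.mk b}]
    abel

/-- The partial derivative of the expression `e` with respect to the variable `x`, along the
term `u`. -/
def Expr.pdiff {κ : Kind} (x : ℕ) (u : Expr Kind.tm) (e : Expr κ) : Multiset (Expr κ) :=
  Quotient.liftOn e (Raw.pdiff x u) fun _ _ h => Raw.pdiff_congr h x u

theorem Raw.fv_rename {κ : Kind} (e : Raw κ) :
    ∀ f : ℕ → ℕ, (e.rename f).fv = f '' e.fv := by
  induction e with
  | var n => intro f; simp [Raw.rename, Raw.fv]
  | lam s ih =>
    intro f
    ext n
    simp only [Raw.rename, Raw.fv, ih, Set.mem_ofPred_eq, Set.mem_image]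
    constructor
    · rintro ⟨m, hm, h⟩
      cases m with
      | zero => simp [liftRen] at h
      | succ m => exact ⟨m, hm, by simpa [liftRen] using h⟩
    · rintro ⟨m, hm, h⟩
      exact ⟨m + 1, hm, by simp [liftRen, h]⟩
  | app s t ih₁ ih₂ => intro f; simp [Raw.rename, Raw.fv, ih₁, ih₂, Set.image_union]
  | nil => intro f; simp [Raw.rename, Raw.fv]
  | cons s t ih₁ ih₂ => intro f; simp [Raw.rename, Raw.fv, ih₁, ih₂, Set.image_union]

theorem Expr.fv_shift {κ : Kind} (e : Expr κ) : e.shift.fv = Nat.succ '' e.fv := by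
  obtain ⟨e, rfl⟩ := e.mk_surj
  exact Raw.fv_rename e Nat.succ

theorem Raw.pdiff_eq_zero {κ : Kind} (e : Raw κ) :
    ∀ (x : ℕ) (u : Expr Kind.tm), x ∉ e.fv → e.pdiff x u = 0 := by
  induction e with
  | var n =>
    intro x u h
    have h' : n ≠ x := fun hn => h (by simp [Raw.fv, hn])
    simp [Raw.pdiff, h']
  | lam s ih => intro x u h; simp [Raw.pdiff, lamSum, ih (x + 1) u.shift h]
  | app s t ih₁ ih₂ =>
    intro x u h
    simp only [Raw.fv, Set.mem_union, not_or] at h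
    simp [Raw.pdiff, appSum, ih₁ x u h.1, ih₂ x u h.2]
  | nil => intro x u h; rfl
  | cons s t ih₁ ih₂ =>
    intro x u h
    simp only [Raw.fv, Set.mem_union, not_or] at h
    simp [Raw.pdiff, consSum, ih₁ x u h.1, ih₂ x u h.2]

theorem Expr.pdiff_eq_zero {κ : Kind} (e : Expr κ) (x : ℕ) (u : Expr Kind.tm) (h : x ∉ e.fv) :
    Expr.pdiff x u e = 0 := by
  obtain ⟨e, rfl⟩ := e.mk_surj
  exact Raw.pdiff_eq_zero e x u h

theorem Expr.pdiff_lam (x : ℕ) (u s : Expr Kind.tm) :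
    Expr.pdiff x u (Expr.lam s) = lamSum (Expr.pdiff (x + 1) u.shift s) := by
  obtain ⟨s, rfl⟩ := s.mk_surj
  rfl

theorem Expr.pdiff_app (x : ℕ) (u s : Expr Kind.tm) (t : Expr Kind.mon) :
    Expr.pdiff x u (Expr.app s t)
      = (Expr.pdiff x u s).map (fun s' => Expr.app s' t) + (Expr.pdiff x u t).map (Expr.app s) := by
  obtain ⟨s, rfl⟩ := s.mk_surj
  obtain ⟨t, rfl⟩ := t.mk_surj
  refine (show _ = appSum _ _ + appSum _ _ from rfl).trans ?_
  simp [appSum, Multiset.bind_singleton]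
  rfl

theorem Expr.pdiff_cons (x : ℕ) (u s : Expr Kind.tm) (t : Expr Kind.mon) :
    Expr.pdiff x u (Expr.cons s t)
      = (Expr.pdiff x u s).map (fun s' => Expr.cons s' t) + (Expr.pdiff x u t).map (Expr.cons s) := by
  obtain ⟨s, rfl⟩ := s.mk_surj
  obtain ⟨t, rfl⟩ := t.mk_surj
  refine (show _ = consSum _ _ + consSum _ _ from rfl).trans ?_
  simp [consSum, Multiset.bind_singleton]
  rfl

/-- Iterated partial derivatives do not depend on the order. -/
theorem Raw.pdiff_comm {κ : Kind} (e : Raw κ) :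
    ∀ (x : ℕ) (t u : Expr Kind.tm), x ∉ t.fv → x ∉ u.fv →
      (Expr.pdiff x t (Expr.mk e)).bind (Expr.pdiff x u)
        = (Expr.pdiff x u (Expr.mk e)).bind (Expr.pdiff x t) := by
  induction e with
  | var n =>
    intro x t u ht hu
    change (if n = x then {t} else 0 : Multiset (Expr Kind.tm)).bind _
      = (if n = x then {u} else 0 : Multiset (Expr Kind.tm)).bind _
    split_ifs
    · simp [Expr.pdiff_eq_zero _ _ _ ht, Expr.pdiff_eq_zero _ _ _ hu]
    · simp
  | lam s ih =>
    intro x t u ht hu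
    have ht' : x + 1 ∉ t.shift.fv := by
      rw [Expr.fv_shift]; rintro ⟨m, hm, h⟩; exact ht (by rwa [← Nat.succ.inj h])
    have hu' : x + 1 ∉ u.shift.fv := by
      rw [Expr.fv_shift]; rintro ⟨m, hm, h⟩; exact hu (by rwa [← Nat.succ.inj h])
    change (Expr.pdiff x t (Expr.lam (Expr.mk s))).bind _ = (Expr.pdiff x u (Expr.lam (Expr.mk s))).bind _
    have h := congrArg (Multiset.map Expr.lam) (ih (x + 1) _ _ ht' hu')
    simpa [Expr.pdiff_lam, lamSum, Multiset.bind_map, Multiset.map_bind] using h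
  | app s r ih₁ ih₂ =>
    intro x t u ht hu
    have h₁ := congrArg (Multiset.map (fun s' => Expr.app s' (Expr.mk r))) (ih₁ x t u ht hu)
    have h₂ := congrArg (Multiset.map (Expr.app (Expr.mk s))) (ih₂ x t u ht hu)
    have h₃ : ∀ t u : Expr Kind.tm,
        ((Expr.pdiff x t (Expr.mk s)).bind fun a => (Expr.pdiff x u (Expr.mk r)).map (Expr.app a))
        = (Expr.pdiff x u (Expr.mk r)).bind fun b =>
            (Expr.pdiff x t (Expr.mk s)).map (fun a => Expr.app a b) :=
      fun t u => Multiset.bind_map_comm _ _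
    change (Expr.pdiff x t (Expr.app (Expr.mk s) (Expr.mk r))).bind _
      = (Expr.pdiff x u (Expr.app (Expr.mk s) (Expr.mk r))).bind _
    simp only [Multiset.map_bind] at h₁ h₂
    simp only [Expr.pdiff_app, Multiset.add_bind, Multiset.bind_map, Multiset.bind_add]
    rw [h₁, h₂, h₃, h₃]
    abel
  | nil => intro x t u _ _; rfl
  | cons s r ih₁ ih₂ =>
    intro x t u ht hu
    have h₁ := congrArg (Multiset.map (fun s' => Expr.cons s' (Expr.mk r))) (ih₁ x t u ht hu)
    have h₂ := congrArg (Multiset.map (Expr.cons (Expr.mk s))) (ih₂ x t u ht hu)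
    have h₃ : ∀ t u : Expr Kind.tm,
        ((Expr.pdiff x t (Expr.mk s)).bind fun a => (Expr.pdiff x u (Expr.mk r)).map (Expr.cons a))
        = (Expr.pdiff x u (Expr.mk r)).bind fun b =>
            (Expr.pdiff x t (Expr.mk s)).map (fun a => Expr.cons a b) :=
      fun t u => Multiset.bind_map_comm _ _
    change (Expr.pdiff x t (Expr.cons (Expr.mk s) (Expr.mk r))).bind _
      = (Expr.pdiff x u (Expr.cons (Expr.mk s) (Expr.mk r))).bind _
    simp only [Multiset.map_bind] at h₁ h₂
    simp only [Expr.pdiff_cons, Multiset.add_bind, Multiset.bind_map, Multiset.bind_add]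
    rw [h₁, h₂, h₃, h₃]
    abel

/-- Derivative of a finite sum with respect to the variable `0`, along a term `u` that lives
outside of the binder of `0`. -/
def diffStep {κ : Kind} (u : Expr Kind.tm) (ε : Multiset (Expr κ)) : Multiset (Expr κ) :=
  ε.bind (Expr.pdiff 0 u.shift)

instance diffStep_leftCommutative {κ : Kind} : LeftCommutative (diffStep (κ := κ)) where
  left_comm t u ε := by
    have h0 : ∀ v : Expr Kind.tm, 0 ∉ v.shift.fv := by
      intro v
      rw [Expr.fv_shift]
      rintro ⟨m, _, h⟩
      exact Nat.succ_ne_zero m h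
    simp only [diffStep, Multiset.bind_assoc]
    refine Multiset.bind_congr fun e _ => ?_
    obtain ⟨e, rfl⟩ := e.mk_surj
    exact Raw.pdiff_comm e 0 u.shift t.shift (h0 u) (h0 t)

/-- The iterated partial derivative of `e` with respect to the variable `0`, along all the
elements of the monomial `t`. -/
def Expr.npdiff {κ : Kind} (e : Expr κ) (t : Expr Kind.mon) : Multiset (Expr κ) :=
  t.elems.foldr diffStep {e}

open Classical in
/-- Substitution of the empty sum `0` for the variable `0` in `e` (the binder of which is then
removed): the result is `0` if the variable is free in `e`, and `e` otherwise. -/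
noncomputable def Expr.substZero {κ : Kind} (e : Expr κ) : Multiset (Expr κ) :=
  if 0 ∈ e.fv then 0 else {e.unshift}

/-- The multilinear substitution of the elements of the monomial `t` for the variable `0` in `e`:
the iterated derivative at zero. The reduct of `app (lam s) t` is `s.lsubst t`. -/
noncomputable def Expr.lsubst {κ : Kind} (e : Expr κ) (t : Expr Kind.mon) :
    Multiset (Expr κ) :=
  (e.npdiff t).bind Expr.substZero

/-- Bilinear extension of the multilinear substitution to finite sums. -/
noncomputable def lsubstSum {κ : Kind} (ε : Multiset (Expr κ)) (τ : Multiset (Expr Kind.mon)) :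
    Multiset (Expr κ) :=
  ε.bind fun e => τ.bind fun t => e.lsubst t

/-! ### Parallel reduction and full parallel reduct -/

/-- Parallel resource reduction, from expressions to finite sums of expressions. The rule for
monomials is split along the construction of monomials by `nil` and `cons`. -/
inductive ParRed : {κ : Kind} → Expr κ → Multiset (Expr κ) → Prop
  | var (n : ℕ) : ParRed (Expr.var n) {Expr.var n}
  | redex {s : Expr Kind.tm} {t : Expr Kind.mon} {σ : Multiset (Expr Kind.tm)}
      {τ : Multiset (Expr Kind.mon)} :
      ParRed s σ → ParRed t τ → ParRed (Expr.app (Expr.lam s) t) (lsubstSum σ τ)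
  | lam {s : Expr Kind.tm} {σ : Multiset (Expr Kind.tm)} :
      ParRed s σ → ParRed (Expr.lam s) (lamSum σ)
  | app {s : Expr Kind.tm} {t : Expr Kind.mon} {σ : Multiset (Expr Kind.tm)}
      {τ : Multiset (Expr Kind.mon)} :
      ParRed s σ → ParRed t τ → ParRed (Expr.app s t) (appSum σ τ)
  | nil : ParRed Expr.nil {Expr.nil}
  | cons {s : Expr Kind.tm} {t : Expr Kind.mon} {σ : Multiset (Expr Kind.tm)}
      {τ : Multiset (Expr Kind.mon)} :
      ParRed s σ → ParRed t τ → ParRed (Expr.cons s t) (consSum σ τ)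

/-- The full parallel reduct of a raw expression. -/
noncomputable def Raw.fullReduct : {κ : Kind} → Raw κ → Multiset (Expr κ)
  | _, Raw.var n => {Expr.var n}
  | _, Raw.lam s => lamSum s.fullReduct
  | _, Raw.app (Raw.lam s) t => lsubstSum s.fullReduct t.fullReduct
  | _, Raw.app s t => appSum s.fullReduct t.fullReduct
  | _, Raw.nil => {Expr.nil}
  | _, Raw.cons s t => consSum s.fullReduct t.fullReduct

/-- The body of an abstraction. -/
def Raw.body : {κ : Kind} → Raw κ → Option (Expr Kind.tm)
  | _, Raw.lam s => some (Expr.mk s)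
  | _, _ => none

theorem Raw.body_congr {κ : Kind} {e f : Raw κ} (h : Raw.Equiv e f) : e.body = f.body := by
  induction h with
  | refl e => rfl
  | symm _ ih => exact ih.symm
  | trans _ _ ih₁ ih₂ => exact ih₁.trans ih₂
  | lam h _ => simp [Raw.body, Expr.mk_eq h]
  | app _ _ _ _ => rfl
  | cons _ _ _ _ => rfl
  | swap a b t => rfl

theorem Expr.lam_injective : Function.Injective Expr.lam := by
  intro s s' h
  obtain ⟨s, rfl⟩ := s.mk_surj
  obtain ⟨s', rfl⟩ := s'.mk_surj
  have h' : Raw.Equiv (Raw.lam s) (Raw.lam s') := Quotient.exact (s := Raw.setoid _) h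
  exact Option.some.inj (Raw.body_congr h')

theorem Raw.fullReduct_app_of_body (s : Raw Kind.tm) (t : Raw Kind.mon) (h : s.body = none) :
    (Raw.app s t).fullReduct = appSum s.fullReduct t.fullReduct := by
  cases s with
  | var n => simp [Raw.fullReduct]
  | lam s => simp [Raw.body] at h
  | app s r => rw [Raw.fullReduct]; simp

theorem Raw.exists_lam_of_body (s : Raw Kind.tm) (b : Expr Kind.tm) (h : s.body = some b) :
    ∃ r : Raw Kind.tm, s = Raw.lam r := by
  cases s with
  | var n => simp [Raw.body] at h
  | lam s => exact ⟨s, rfl⟩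
  | app s r => simp [Raw.body] at h

theorem Raw.fullReduct_congr {κ : Kind} {e f : Raw κ} (h : Raw.Equiv e f) :
    e.fullReduct = f.fullReduct := by
  induction h with
  | refl e => rfl
  | symm _ ih => exact ih.symm
  | trans _ _ ih₁ ih₂ => exact ih₁.trans ih₂
  | lam _ ih => simp [Raw.fullReduct, ih]
  | @app s s' t t' h₁ h₂ ih₁ ih₂ =>
    have hb := Raw.body_congr h₁
    cases hs : s.body with
    | none =>
      rw [Raw.fullReduct_app_of_body s t hs, Raw.fullReduct_app_of_body s' t' (hb ▸ hs), ih₁, ih₂]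
    | some b =>
      obtain ⟨r, rfl⟩ := Raw.exists_lam_of_body s b hs
      obtain ⟨r', rfl⟩ := Raw.exists_lam_of_body s' b (hb ▸ hs)
      have hr : r.fullReduct = r'.fullReduct :=
        Multiset.map_injective Expr.lam_injective (by simpa [Raw.fullReduct, lamSum] using ih₁)
      simp only [Raw.fullReduct, hr, ih₂]
  | cons _ _ ih₁ ih₂ => simp only [Raw.fullReduct, ih₁, ih₂]
  | swap a b t => simp only [Raw.fullReduct]; exact consSum_swap _ _ _

/-- The full parallel reduct of an expression: all its redexes are fired. -/
noncomputable def Expr.fullReduct {κ : Kind} (e : Expr κ) : Multiset (Expr κ) :=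
  Quotient.liftOn e Raw.fullReduct fun _ _ h => Raw.fullReduct_congr h

/-! ### Resource vectors -/

section Vectors

variable {S : Type*} [CommSemiring S] {X I : Type*} {κ : Kind}

/-- A family of vectors is summable if each coordinate is nonzero finitely often. -/
def SummableFamily (ξ : I → X → S) : Prop :=
  ∀ x : X, {i : I | ξ i x ≠ 0}.Finite

/-- The pointwise sum of a summable family of vectors. -/
noncomputable def vecSum (ξ : I → X → S) : X → S :=
  fun x => ∑ᶠ i : I, ξ i x

open Classical in
/-- A finite sum of expressions as a vector, through the semiring morphism from `ℕ` to `S`. -/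
noncomputable def toVec (S : Type*) [CommSemiring S] (σ : Multiset (Expr κ)) : Expr κ → S :=
  fun e => (σ.count e : S)

/-- The set of free variables of a set of expressions. -/
def fvSet (E : Set (Expr κ)) : Set ℕ := ⋃ e ∈ E, e.fv

/-- Resource vectors are the vectors with finitely many free variables. -/
def IsResourceVector (ε : Expr κ → S) : Prop := (fvSet (Function.support ε)).Finite

/-- A resource vector is bounded if its support has bounded height. -/
def IsBounded (ε : Expr κ → S) : Prop := (Expr.height '' Function.support ε).Finite

/-- The full parallel reduct of a vector (meaningful if the family of the full reducts of the
elements of its support is summable). -/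
noncomputable def vecFullReduct (ε : Expr κ → S) : Expr κ → S :=
  vecSum fun e : Function.support ε => ε e • toVec S (e : Expr κ).fullReduct

/-- Reflexive closure of a relation from expressions to finite sums. -/
def ReflClosure (R : Expr κ → Multiset (Expr κ) → Prop) (e : Expr κ) (ε : Multiset (Expr κ)) :
    Prop :=
  R e ε ∨ ε = {e}

/-- The extension of `R` to resource vectors, restricted to reductions of elements of `E`. -/
def VecRedOn (R : Expr κ → Multiset (Expr κ) → Prop) (E : Set (Expr κ)) (ε ε' : Expr κ → S) :
    Prop :=
  IsResourceVector ε ∧ IsResourceVector ε' ∧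
    ∃ (I : Type) (a : I → S) (e : I → Expr κ) (φ : I → Multiset (Expr κ)),
      SummableFamily (fun i => toVec S {e i}) ∧ ε = vecSum (fun i => a i • toVec S {e i}) ∧
      SummableFamily (fun i => toVec S (φ i)) ∧ ε' = vecSum (fun i => a i • toVec S (φ i)) ∧
      ∀ i, e i ∈ E ∧ ReflClosure R (e i) (φ i)

/-- The union of the reductions `VecRedOn R E` for `E` in a structure `𝔈`. -/
def VecRed (R : Expr κ → Multiset (Expr κ) → Prop) (𝔈 : Set (Set (Expr κ)))
    (ε ε' : Expr κ → S) : Prop :=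
  ∃ E ∈ 𝔈, VecRedOn R E ε ε'

end Vectors

/-! ### Reduction structures -/

/-- A resource structure is a set of resource supports (sets of expressions with finitely many
free variables) that contains the finite ones, and is closed under finite unions and subsets. -/
structure IsResourceStructure {κ : Kind} (𝔈 : Set (Set (Expr κ))) : Prop where
  finite_fv : ∀ E ∈ 𝔈, (fvSet E).Finite
  finite_mem : ∀ E : Set (Expr κ), E.Finite → (fvSet E).Finite → E ∈ 𝔈
  union_mem : ∀ E ∈ 𝔈, ∀ F ∈ 𝔈, E ∪ F ∈ 𝔈
  subset_mem : ∀ E ∈ 𝔈, ∀ F : Set (Expr κ), F ⊆ E → F ∈ 𝔈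

/-- A reduction structure for `R` is a resource structure closed under taking the supports of the
reducts. -/
structure IsReductionStructure {κ : Kind} (R : Expr κ → Multiset (Expr κ) → Prop)
    (𝔈 : Set (Set (Expr κ))) : Prop extends IsResourceStructure 𝔈 where
  reduct_mem : ∀ E ∈ 𝔈, {e' | ∃ e ∈ E, ∃ φ, ReflClosure R e φ ∧ e' ∈ φ} ∈ 𝔈

/-- The structure of all sets of expressions with bounded height and finitely many free
variables. -/
def boundedStructure (κ : Kind) : Set (Set (Expr κ)) :=
  {E | (Expr.height '' E).Finite ∧ (fvSet E).Finite}

/-- Bounded reduction structures: reduction structures for parallel reduction, all the elements of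
which have bounded height. -/
def IsBoundedReductionStructure {κ : Kind} (𝔈 : Set (Set (Expr κ))) : Prop :=
  IsReductionStructure ParRed 𝔈 ∧ 𝔈 ⊆ boundedStructure κ

end ResourceCalculus

open ResourceCalculus

namespace ResourceCalculus

/-! ### Expressions up to permutation of monomials -/

/-! The proof carries Takahashi's method over to sums. On expressions, whatever redexes have been
fired in e ⇉ φ, the summands of φ can be reduced in parallel so that their reducts add up to F(e)
(`ParRed.sumRed_fullReduct`). For vectors ε = ∑ aᵢ eᵢ and ε' = ∑ aᵢ φᵢ, this is applied to each i:
every summand of φᵢ keeps the coefficient aᵢ, and the reducts add up to ∑ aᵢ F(eᵢ) = F(ε). No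
cancellation or subtraction is involved, so any commutative semiring will do. As F(ε) depends on ε
alone, it closes every peak.

Two points need work. The first is that ⇉ passes through multilinear substitution (`SumRed.lsubst`).
Iterated derivatives are awkward for inductions on expressions, so they are replaced by a
simultaneous linear substitution, defined by recursion, in which the multiset of resources is split
between the children of each node (`Expr.lsubst_eq`). The redex case then rests on the composition
law `Expr.linSubst_linSubst`, the resource analogue of s[t/x][u/y] = s[u/y][t[u/y]/x].

The second is that all the sums are pointwise finite. Linear substitution erases nothing, so a
reduct can be smaller than its source only by the fired nodes and by the merging of size bounds at
each level. This costs a factor 4 per unit of height (`ParRed.size_le`). With height and free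
variables bounded, a given expression therefore occurs in reducts of only finitely many expressions
(`finite_antecedents`). Exponential control of heights (`ParRed.height_le`) and `ParRed.fv_subset`
show that the bounded sets are closed under reduction. -/

theorem Expr.ind {motive : ∀ κ : Kind, Expr κ → Prop}
    (var : ∀ n, motive _ (Expr.var n))
    (lam : ∀ s, motive _ s → motive _ (Expr.lam s))
    (app : ∀ s t, motive _ s → motive _ t → motive _ (Expr.app s t))
    (nil : motive _ Expr.nil)
    (cons : ∀ s t, motive _ s → motive _ t → motive _ (Expr.cons s t))
    {κ : Kind} (e : Expr κ) : motive κ e := by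
  obtain ⟨e, rfl⟩ := e.mk_surj
  induction e with
  | var n => exact var n
  | lam s ih => exact lam _ ih
  | app s t ih₁ ih₂ => exact app _ _ ih₁ ih₂
  | nil => exact nil
  | cons s t ih₁ ih₂ => exact cons _ _ ih₁ ih₂

@[simp] theorem Expr.elems_nil : Expr.nil.elems = 0 := rfl

@[simp] theorem Expr.elems_cons (s : Expr Kind.tm) (t : Expr Kind.mon) :
    (Expr.cons s t).elems = s ::ₘ t.elems := by
  obtain ⟨s, rfl⟩ := s.mk_surj
  obtain ⟨t, rfl⟩ := t.mk_surj
  rfl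

instance Expr.cons_leftCommutative : LeftCommutative Expr.cons := ⟨Expr.cons_swap⟩

/-- The monomial with given elements. -/
def Expr.ofMultiset (m : Multiset (Expr Kind.tm)) : Expr Kind.mon := m.foldr Expr.cons Expr.nil

@[simp] theorem Expr.ofMultiset_zero : Expr.ofMultiset 0 = Expr.nil := rfl

@[simp] theorem Expr.ofMultiset_cons (s : Expr Kind.tm) (m : Multiset (Expr Kind.tm)) :
    Expr.ofMultiset (s ::ₘ m) = Expr.cons s (Expr.ofMultiset m) := by
  simp [Expr.ofMultiset]

theorem Expr.mon_ind {motive : Expr Kind.mon → Prop} (nil : motive Expr.nil)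
    (cons : ∀ s t, motive t → motive (Expr.cons s t)) (t : Expr Kind.mon) : motive t := by
  -- The induction ranges over both sorts at once; the equation on the sort discards the term cases.
  refine Expr.ind (motive := fun κ e => ∀ h : κ = Kind.mon, motive (h ▸ e))
    ?_ ?_ ?_ ?_ ?_ t rfl
  · rintro n ⟨⟩
  · rintro s - ⟨⟩
  · rintro s t - - ⟨⟩
  · intro _; exact nil
  · intro s t _ ih _; exact cons s t (ih rfl)

@[simp] theorem Expr.ofMultiset_elems (t : Expr Kind.mon) : Expr.ofMultiset t.elems = t := by
  induction t using Expr.mon_ind with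
  | nil => rfl
  | cons s t ih => simp [ih]

@[simp] theorem Expr.rename_var (f : ℕ → ℕ) (n : ℕ) :
    (Expr.var n).rename f = Expr.var (f n) := rfl

@[simp] theorem Expr.rename_lam (f : ℕ → ℕ) (s : Expr Kind.tm) :
    (Expr.lam s).rename f = Expr.lam (s.rename (liftRen f)) := by
  obtain ⟨s, rfl⟩ := s.mk_surj
  rfl

@[simp] theorem Expr.rename_app (f : ℕ → ℕ) (s : Expr Kind.tm) (t : Expr Kind.mon) :
    (Expr.app s t).rename f = Expr.app (s.rename f) (t.rename f) := by
  obtain ⟨s, rfl⟩ := s.mk_surj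
  obtain ⟨t, rfl⟩ := t.mk_surj
  rfl

@[simp] theorem Expr.rename_nil (f : ℕ → ℕ) : Expr.nil.rename f = Expr.nil := rfl

@[simp] theorem Expr.rename_cons (f : ℕ → ℕ) (s : Expr Kind.tm) (t : Expr Kind.mon) :
    (Expr.cons s t).rename f = Expr.cons (s.rename f) (t.rename f) := by
  obtain ⟨s, rfl⟩ := s.mk_surj
  obtain ⟨t, rfl⟩ := t.mk_surj
  rfl

theorem liftRen_comp (f g : ℕ → ℕ) : liftRen f ∘ liftRen g = liftRen (f ∘ g) := by
  funext n; cases n <;> rfl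

theorem Expr.rename_rename {κ : Kind} (e : Expr κ) :
    ∀ f g : ℕ → ℕ, (e.rename g).rename f = e.rename (f ∘ g) := by
  induction e using Expr.ind with
  | var n => intro f g; rfl
  | lam s ih => intro f g; simp [ih, liftRen_comp]
  | app s t ih₁ ih₂ => intro f g; simp [ih₁, ih₂]
  | nil => intro f g; rfl
  | cons s t ih₁ ih₂ => intro f g; simp [ih₁, ih₂]

theorem Expr.rename_shift {κ : Kind} (f : ℕ → ℕ) (e : Expr κ) :
    e.shift.rename (liftRen f) = (e.rename f).shift := by
  simp only [Expr.shift, Expr.rename_rename]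
  rfl

theorem Expr.elems_rename (f : ℕ → ℕ) (t : Expr Kind.mon) :
    (t.rename f).elems = t.elems.map (Expr.rename f) := by
  induction t using Expr.mon_ind with
  | nil => rfl
  | cons s t ih => simp [ih]

@[simp] theorem Expr.fv_var (n : ℕ) : (Expr.var n).fv = {n} := rfl

@[simp] theorem Expr.fv_lam (s : Expr Kind.tm) : (Expr.lam s).fv = {n | n + 1 ∈ s.fv} := by
  obtain ⟨s, rfl⟩ := s.mk_surj
  rfl

@[simp] theorem Expr.fv_app (s : Expr Kind.tm) (t : Expr Kind.mon) :
    (Expr.app s t).fv = s.fv ∪ t.fv := by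
  obtain ⟨s, rfl⟩ := s.mk_surj
  obtain ⟨t, rfl⟩ := t.mk_surj
  rfl

@[simp] theorem Expr.fv_nil : Expr.nil.fv = ∅ := rfl

@[simp] theorem Expr.fv_cons (s : Expr Kind.tm) (t : Expr Kind.mon) :
    (Expr.cons s t).fv = s.fv ∪ t.fv := by
  obtain ⟨s, rfl⟩ := s.mk_surj
  obtain ⟨t, rfl⟩ := t.mk_surj
  rfl

@[simp] theorem Expr.height_var (n : ℕ) : (Expr.var n).height = 1 := rfl

@[simp] theorem Expr.height_lam (s : Expr Kind.tm) : (Expr.lam s).height = 1 + s.height := by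
  obtain ⟨s, rfl⟩ := s.mk_surj
  rfl

@[simp] theorem Expr.height_app (s : Expr Kind.tm) (t : Expr Kind.mon) :
    (Expr.app s t).height = max s.height (1 + t.height) := by
  obtain ⟨s, rfl⟩ := s.mk_surj
  obtain ⟨t, rfl⟩ := t.mk_surj
  rfl

@[simp] theorem Expr.height_nil : Expr.nil.height = 0 := rfl

@[simp] theorem Expr.height_cons (s : Expr Kind.tm) (t : Expr Kind.mon) :
    (Expr.cons s t).height = max s.height t.height := by
  obtain ⟨s, rfl⟩ := s.mk_surj
  obtain ⟨t, rfl⟩ := t.mk_surj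
  rfl

/-! ### Sums over the splittings of a multiset -/

section Split

variable {α β γ δ : Type*}

/-- The sum of `F x y` over all the ways to split `m` as `x + y`. -/
def split (m : Multiset α) (F : Multiset α → Multiset α → Multiset β) : Multiset β :=
  m.antidiagonal.bind fun p => F p.1 p.2

@[simp] theorem split_zero (F : Multiset α → Multiset α → Multiset β) : split 0 F = F 0 0 := by
  simp [split]

@[simp] theorem split_cons (a : α) (m : Multiset α)
    (F : Multiset α → Multiset α → Multiset β) :
    split (a ::ₘ m) F = split m (fun x y => F x (a ::ₘ y)) + split m (fun x y => F (a ::ₘ x) y) := by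
  simp [split, Multiset.antidiagonal_cons, Multiset.add_bind, Multiset.bind_map]

theorem split_congr {m : Multiset α} {F G : Multiset α → Multiset α → Multiset β}
    (h : ∀ x y, x + y = m → F x y = G x y) : split m F = split m G :=
  Multiset.bind_congr fun p hp => h p.1 p.2 (Multiset.mem_antidiagonal.1 hp)

theorem mem_split {m : Multiset α} {F : Multiset α → Multiset α → Multiset β} {b : β} :
    b ∈ split m F ↔ ∃ x y, x + y = m ∧ b ∈ F x y := by
  simp [split, Multiset.mem_bind]

theorem split_map (f : α → γ) (m : Multiset α) :
    ∀ F : Multiset γ → Multiset γ → Multiset β,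
      split (m.map f) F = split m fun x y => F (x.map f) (y.map f) := by
  induction m using Multiset.induction with
  | empty => intro F; simp
  | cons a m ih => intro F; simp [ih]

theorem split_bind (m : Multiset α) (F : Multiset α → Multiset α → Multiset β)
    (G : β → Multiset γ) : (split m F).bind G = split m fun x y => (F x y).bind G :=
  Multiset.bind_assoc ..

theorem map_split (m : Multiset α) (F : Multiset α → Multiset α → Multiset β)
    (f : β → γ) : (split m F).map f = split m fun x y => (F x y).map f :=
  Multiset.map_bind ..

theorem bind_split (s : Multiset γ) (m : Multiset α)
    (F : γ → Multiset α → Multiset α → Multiset β) :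
    (s.bind fun c => split m (F c)) = split m fun x y => s.bind fun c => F c x y :=
  Multiset.bind_bind ..

theorem split_split (m : Multiset α) (n : Multiset γ)
    (F : Multiset α → Multiset α → Multiset γ → Multiset γ → Multiset β) :
    (split m fun x y => split n (F x y)) = split n fun p q => split m fun x y => F x y p q :=
  Multiset.bind_bind ..

theorem split_add (m : Multiset α) (F G : Multiset α → Multiset α → Multiset β) :
    (split m fun x y => F x y + G x y) = split m F + split m G := by
  simp [split, Multiset.bind_add]

@[simp] theorem split_empty (m : Multiset α) :
    (split m fun _ _ => (0 : Multiset β)) = 0 := by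
  simp [split]

/-- Iterated splittings only distribute the elements of `m` among labelled slots, so the slots can
be permuted or regrouped. This law, `split_assoc` and `split_exchange` are cocommutativity and
coassociativity of the unshuffle coproduct; each induction puts one more element into every slot in
turn. -/
theorem split_left_comm (m : Multiset α) :
    ∀ G : Multiset α → Multiset α → Multiset α → Multiset β,
      (split m fun x y => split y fun p q => G x p q)
        = split m fun x y => split y fun p q => G p x q := by
  induction m using Multiset.induction with
  | empty => intro G; simp
  | cons a m ih =>
    intro G
    simp only [split_cons, split_add]
    rw [ih fun x p q => G x p (a ::ₘ q), ih fun x p q => G x (a ::ₘ p) q,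
      ih fun x p q => G (a ::ₘ x) p q]
    abel

theorem split_assoc (m : Multiset α) :
    ∀ G : Multiset α → Multiset α → Multiset α → Multiset β,
      (split m fun x y => split y fun p q => G x p q)
        = split m fun x y => split x fun p q => G p q y := by
  induction m using Multiset.induction with
  | empty => intro G; simp
  | cons a m ih =>
    intro G
    simp only [split_cons, split_add]
    rw [ih fun x p q => G x p (a ::ₘ q), ih fun x p q => G x (a ::ₘ p) q,
      ih fun x p q => G (a ::ₘ x) p q]
    abel

theorem split_exchange (m : Multiset α) :
    ∀ G : Multiset α → Multiset α → Multiset α → Multiset α → Multiset β,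
      (split m fun x y => split x fun a b => split y fun c d => G a b c d)
        = split m fun x y => split x fun a c => split y fun b d => G a b c d := by
  induction m using Multiset.induction with
  | empty => intro G; simp
  | cons a m ih =>
    intro G
    simp only [split_cons, split_add]
    rw [ih fun p q r s => G p q r (a ::ₘ s), ih fun p q r s => G p q (a ::ₘ r) s,
      ih fun p q r s => G p (a ::ₘ q) r s, ih fun p q r s => G (a ::ₘ p) q r s]
    abel

theorem split_comm (m : Multiset α) :
    ∀ F : Multiset α → Multiset α → Multiset β, split m F = split m fun x y => F y x := by
  induction m using Multiset.induction with
  | empty => intro F; simp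
  | cons a m ih =>
    intro F
    rw [split_cons, split_cons, ih fun x y => F x (a ::ₘ y), ih fun x y => F (a ::ₘ x) y, add_comm]

-- Counit law: splittings are counted with multiplicity, but the one with empty first part occurs
-- exactly once, even if `m` has repeated elements.
open Classical in
theorem split_ite_left (m : Multiset α) :
    ∀ F : Multiset α → Multiset β, (split m fun x y => if x = 0 then F y else 0) = F m := by
  induction m using Multiset.induction with
  | empty => intro F; simp
  | cons a m ih => intro F; simp [ih fun y => F (a ::ₘ y)]

open Classical in
theorem split_ite_right (m : Multiset α) (F : Multiset α → Multiset β) :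
    (split m fun x y => if y = 0 then F x else 0) = F m := by
  rw [split_comm, split_ite_left]

end Split

/-! ### Linearity of the constructions on sums -/

section Linear

variable {α : Type*}

theorem appSum_bind_left (σ : Multiset α) (f : α → Multiset (Expr Kind.tm))
    (τ : Multiset (Expr Kind.mon)) :
    appSum (σ.bind f) τ = σ.bind fun a => appSum (f a) τ := Multiset.bind_assoc ..

theorem appSum_bind_right (σ : Multiset (Expr Kind.tm)) (τ : Multiset α)
    (f : α → Multiset (Expr Kind.mon)) :
    appSum σ (τ.bind f) = τ.bind fun a => appSum σ (f a) := by
  simp only [appSum, Multiset.map_bind]; rw [Multiset.bind_bind]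

theorem consSum_bind_left (σ : Multiset α) (f : α → Multiset (Expr Kind.tm))
    (τ : Multiset (Expr Kind.mon)) :
    consSum (σ.bind f) τ = σ.bind fun a => consSum (f a) τ := Multiset.bind_assoc ..

theorem consSum_bind_right (σ : Multiset (Expr Kind.tm)) (τ : Multiset α)
    (f : α → Multiset (Expr Kind.mon)) :
    consSum σ (τ.bind f) = τ.bind fun a => consSum σ (f a) := by
  simp only [consSum, Multiset.map_bind]; rw [Multiset.bind_bind]

theorem appSum_split_left (m : Multiset α)
    (F : Multiset α → Multiset α → Multiset (Expr Kind.tm)) (τ : Multiset (Expr Kind.mon)) :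
    appSum (split m F) τ = split m fun x y => appSum (F x y) τ :=
  appSum_bind_left ..

theorem appSum_split_right (σ : Multiset (Expr Kind.tm)) (m : Multiset α)
    (F : Multiset α → Multiset α → Multiset (Expr Kind.mon)) :
    appSum σ (split m F) = split m fun x y => appSum σ (F x y) :=
  appSum_bind_right ..

theorem consSum_split_left (m : Multiset α)
    (F : Multiset α → Multiset α → Multiset (Expr Kind.tm)) (τ : Multiset (Expr Kind.mon)) :
    consSum (split m F) τ = split m fun x y => consSum (F x y) τ :=
  consSum_bind_left ..

theorem consSum_split_right (σ : Multiset (Expr Kind.tm)) (m : Multiset α)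
    (F : Multiset α → Multiset α → Multiset (Expr Kind.mon)) :
    consSum σ (split m F) = split m fun x y => consSum σ (F x y) :=
  consSum_bind_right ..

theorem mem_lamSum {σ : Multiset (Expr Kind.tm)} {e : Expr Kind.tm} :
    e ∈ lamSum σ ↔ ∃ s ∈ σ, Expr.lam s = e := Multiset.mem_map

theorem mem_appSum {σ : Multiset (Expr Kind.tm)} {τ : Multiset (Expr Kind.mon)}
    {e : Expr Kind.tm} : e ∈ appSum σ τ ↔ ∃ s ∈ σ, ∃ t ∈ τ, Expr.app s t = e := by
  simp [appSum, Multiset.mem_bind]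

theorem mem_consSum {σ : Multiset (Expr Kind.tm)} {τ : Multiset (Expr Kind.mon)}
    {e : Expr Kind.mon} : e ∈ consSum σ τ ↔ ∃ s ∈ σ, ∃ t ∈ τ, Expr.cons s t = e := by
  simp [consSum, Multiset.mem_bind]

theorem mem_lsubstSum {κ : Kind} {σ : Multiset (Expr κ)} {τ : Multiset (Expr Kind.mon)}
    {e : Expr κ} : e ∈ lsubstSum σ τ ↔ ∃ s ∈ σ, ∃ t ∈ τ, e ∈ s.lsubst t := by
  simp [lsubstSum, Multiset.mem_bind]

@[simp] theorem appSum_zero_left (τ : Multiset (Expr Kind.mon)) : appSum 0 τ = 0 := rfl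
@[simp] theorem appSum_zero_right (σ : Multiset (Expr Kind.tm)) : appSum σ 0 = 0 := by
  simp [appSum]
@[simp] theorem consSum_zero_left (τ : Multiset (Expr Kind.mon)) : consSum 0 τ = 0 := rfl
@[simp] theorem consSum_zero_right (σ : Multiset (Expr Kind.tm)) : consSum σ 0 = 0 := by
  simp [consSum]
@[simp] theorem lamSum_zero : lamSum 0 = 0 := rfl
@[simp] theorem lamSum_singleton (s : Expr Kind.tm) : lamSum {s} = {Expr.lam s} := rfl
@[simp] theorem appSum_singleton (s : Expr Kind.tm) (t : Expr Kind.mon) :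
    appSum {s} {t} = {Expr.app s t} := by simp [appSum]
@[simp] theorem consSum_singleton (s : Expr Kind.tm) (t : Expr Kind.mon) :
    consSum {s} {t} = {Expr.cons s t} := by simp [consSum]

end Linear

/-! ### Simultaneous linear substitution -/

/-- The assignment `f` below a binder. -/
def liftLin (f : ℕ → Option ℕ) : ℕ → Option ℕ
  | 0 => some 0
  | n + 1 => (f n).map Nat.succ

open Classical in
/-- The sum of all the ways to replace the occurrences of the linear variables of `e` (those `n`
with `f n = none`) by the elements of `m`, each being used exactly once. The other variables are
renamed along `f`. -/
noncomputable def Raw.linSubst : {κ : Kind} → (ℕ → Option ℕ) → Multiset (Expr Kind.tm) → Raw κ →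
    Multiset (Expr κ)
  | _, f, m, Raw.var n =>
    match f n with
    | none => if m.card = 1 then m else 0
    | some k => if m = 0 then {Expr.var k} else 0
  | _, f, m, Raw.lam s => lamSum (s.linSubst (liftLin f) (m.map Expr.shift))
  | _, f, m, Raw.app s t => split m fun x y => appSum (s.linSubst f x) (t.linSubst f y)
  | _, _, m, Raw.nil => if m = 0 then {Expr.nil} else 0
  | _, f, m, Raw.cons s t => split m fun x y => consSum (s.linSubst f x) (t.linSubst f y)

theorem Raw.linSubst_congr {κ : Kind} {e e' : Raw κ} (h : Raw.Equiv e e') :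
    ∀ f m, e.linSubst f m = e'.linSubst f m := by
  induction h with
  | refl e => exact fun _ _ => rfl
  | symm _ ih => exact fun f m => (ih f m).symm
  | trans _ _ ih₁ ih₂ => exact fun f m => (ih₁ f m).trans (ih₂ f m)
  | lam _ ih => intro f m; simp [Raw.linSubst, ih]
  | app _ _ ih₁ ih₂ => intro f m; simp [Raw.linSubst, ih₁, ih₂]
  | cons _ _ ih₁ ih₂ => intro f m; simp [Raw.linSubst, ih₁, ih₂]
  | swap a b t =>
    intro f m
    simp only [Raw.linSubst, consSum_split_right]
    -- The shares given to `a` and `b` are exchanged, then `consSum_swap` exchanges the two heads.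
    rw [split_left_comm]
    simp only [consSum_swap (b.linSubst f _)]

/-- Simultaneous linear substitution in an expression. -/
noncomputable def Expr.linSubst {κ : Kind} (f : ℕ → Option ℕ) (m : Multiset (Expr Kind.tm))
    (e : Expr κ) : Multiset (Expr κ) :=
  Quotient.liftOn e (Raw.linSubst f m) fun _ _ h => Raw.linSubst_congr h f m

open Classical in
theorem Expr.linSubst_var_none {f : ℕ → Option ℕ} {n : ℕ} (h : f n = none)
    (m : Multiset (Expr Kind.tm)) :
    (Expr.var n).linSubst f m = if m.card = 1 then m else 0 := by
  change (Raw.var n).linSubst f m = _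
  simp only [Raw.linSubst, h]

open Classical in
theorem Expr.linSubst_var_some {f : ℕ → Option ℕ} {n k : ℕ} (h : f n = some k)
    (m : Multiset (Expr Kind.tm)) :
    (Expr.var n).linSubst f m = if m = 0 then {Expr.var k} else 0 := by
  change (Raw.var n).linSubst f m = _
  simp only [Raw.linSubst, h]

theorem Expr.linSubst_lam (f : ℕ → Option ℕ) (m : Multiset (Expr Kind.tm)) (s : Expr Kind.tm) :
    (Expr.lam s).linSubst f m = lamSum (s.linSubst (liftLin f) (m.map Expr.shift)) := by
  obtain ⟨s, rfl⟩ := s.mk_surj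
  rfl

theorem Expr.linSubst_app (f : ℕ → Option ℕ) (m : Multiset (Expr Kind.tm)) (s : Expr Kind.tm)
    (t : Expr Kind.mon) :
    (Expr.app s t).linSubst f m
      = split m fun x y => appSum (s.linSubst f x) (t.linSubst f y) := by
  obtain ⟨s, rfl⟩ := s.mk_surj
  obtain ⟨t, rfl⟩ := t.mk_surj
  rfl

open Classical in
theorem Expr.linSubst_nil (f : ℕ → Option ℕ) (m : Multiset (Expr Kind.tm)) :
    Expr.nil.linSubst f m = if m = 0 then {Expr.nil} else 0 := rfl

theorem Expr.linSubst_cons (f : ℕ → Option ℕ) (m : Multiset (Expr Kind.tm)) (s : Expr Kind.tm)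
    (t : Expr Kind.mon) :
    (Expr.cons s t).linSubst f m
      = split m fun x y => consSum (s.linSubst f x) (t.linSubst f y) := by
  obtain ⟨s, rfl⟩ := s.mk_surj
  obtain ⟨t, rfl⟩ := t.mk_surj
  rfl

/-! ### Renaming and linear substitution -/

theorem Expr.rename_id {κ : Kind} (e : Expr κ) : e.rename id = e := by
  have hid : liftRen id = id := by funext n; cases n <;> rfl
  induction e using Expr.ind with
  | var n => rfl
  | lam s ih => simp [hid, ih]
  | app s t ih₁ ih₂ => simp [ih₁, ih₂]
  | nil => rfl
  | cons s t ih₁ ih₂ => simp [ih₁, ih₂]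

theorem liftLin_comp_liftRen (g : ℕ → Option ℕ) (f : ℕ → ℕ) :
    liftLin g ∘ liftRen f = liftLin (g ∘ f) := by
  funext n; cases n <;> rfl

theorem liftLin_some (f : ℕ → ℕ) : liftLin (fun n => some (f n)) = fun n => some (liftRen f n) := by
  funext n; cases n <;> rfl

theorem map_liftLin (g : ℕ → Option ℕ) (f : ℕ → ℕ) :
    (fun n => (liftLin g n).map (liftRen f)) = liftLin fun n => (g n).map f := by
  funext n
  cases n with
  | zero => rfl
  | succ n => cases h : g n <;> simp [liftLin, h, liftRen]

theorem Expr.linSubst_rename {κ : Kind} (e : Expr κ) :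
    ∀ (g : ℕ → Option ℕ) (f : ℕ → ℕ) (m : Multiset (Expr Kind.tm)),
      (e.rename f).linSubst g m = e.linSubst (g ∘ f) m := by
  induction e using Expr.ind with
  | var n =>
    intro g f m
    cases h : g (f n) with
    | none => rw [Expr.rename_var, linSubst_var_none h, linSubst_var_none (f := g ∘ f) h]
    | some k => rw [Expr.rename_var, linSubst_var_some h, linSubst_var_some (f := g ∘ f) h]
  | lam s ih => intro g f m; simp [linSubst_lam, ih, liftLin_comp_liftRen]
  | app s t ih₁ ih₂ => intro g f m; simp [linSubst_app, ih₁, ih₂]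
  | nil => intro g f m; rfl
  | cons s t ih₁ ih₂ => intro g f m; simp [linSubst_cons, ih₁, ih₂]

theorem map_rename_lamSum (f : ℕ → ℕ) (σ : Multiset (Expr Kind.tm)) :
    (lamSum σ).map (Expr.rename f) = lamSum (σ.map (Expr.rename (liftRen f))) := by
  simp [lamSum, Multiset.map_map]

theorem map_rename_appSum (f : ℕ → ℕ) (σ : Multiset (Expr Kind.tm))
    (τ : Multiset (Expr Kind.mon)) :
    (appSum σ τ).map (Expr.rename f)
      = appSum (σ.map (Expr.rename f)) (τ.map (Expr.rename f)) := by
  simp [appSum, Multiset.map_map, Multiset.map_bind, Multiset.bind_map]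

theorem map_rename_consSum (f : ℕ → ℕ) (σ : Multiset (Expr Kind.tm))
    (τ : Multiset (Expr Kind.mon)) :
    (consSum σ τ).map (Expr.rename f)
      = consSum (σ.map (Expr.rename f)) (τ.map (Expr.rename f)) := by
  simp [consSum, Multiset.map_map, Multiset.map_bind, Multiset.bind_map]

/-- Together with `Expr.linSubst_rename`, this is naturality in the outer and in the inner
variables. It is what lets substitutions cross binders. -/
theorem Expr.rename_linSubst {κ : Kind} (e : Expr κ) :
    ∀ (g : ℕ → Option ℕ) (f : ℕ → ℕ) (m : Multiset (Expr Kind.tm)),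
      (e.linSubst g m).map (Expr.rename f)
        = e.linSubst (fun n => (g n).map f) (m.map (Expr.rename f)) := by
  induction e using Expr.ind with
  | var n =>
    intro g f m
    cases h : g n with
    | none =>
      rw [linSubst_var_none h, linSubst_var_none (by simp [h])]
      split_ifs <;> simp_all
    | some k =>
      rw [linSubst_var_some h, linSubst_var_some (k := f k) (by simp [h])]
      split_ifs <;> simp_all
  | lam s ih =>
    intro g f m
    simp [linSubst_lam, map_rename_lamSum, ih, Expr.rename_shift, map_liftLin]
  | app s t ih₁ ih₂ =>
    intro g f m
    simp [linSubst_app, map_split, split_map, map_rename_appSum, ih₁, ih₂]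
  | nil =>
    intro g f m
    rw [linSubst_nil, linSubst_nil]
    split_ifs <;> simp_all
  | cons s t ih₁ ih₂ =>
    intro g f m
    simp [linSubst_cons, map_split, split_map, map_rename_consSum, ih₁, ih₂]

open Classical in
theorem Expr.linSubst_of_some {κ : Kind} (e : Expr κ) :
    ∀ (f : ℕ → ℕ) (m : Multiset (Expr Kind.tm)),
      e.linSubst (fun n => some (f n)) m = if m = 0 then {e.rename f} else 0 := by
  have key (α : Type) (m : Multiset (Expr Kind.tm)) (A : Multiset α) :
      (split m fun x y => if x = 0 then if y = 0 then A else 0 else 0)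
        = if m = 0 then A else 0 := by
    exact split_ite_left m fun y => if y = 0 then A else 0
  induction e using Expr.ind with
  | var n => intro f m; rw [linSubst_var_some (f := fun n => some (f n)) rfl]; rfl
  | lam s ih =>
    intro f m
    rw [linSubst_lam, liftLin_some, ih]
    simp only [Multiset.map_eq_zero]
    split_ifs <;> simp
  | app s t ih₁ ih₂ =>
    intro f m
    rw [linSubst_app, ← key]
    refine split_congr fun x y _ => ?_
    rw [ih₁, ih₂]
    split_ifs <;> simp
  | nil => intro f m; rfl
  | cons s t ih₁ ih₂ =>
    intro f m
    rw [linSubst_cons, ← key]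
    refine split_congr fun x y _ => ?_
    rw [ih₁, ih₂]
    split_ifs <;> simp

/-! ### Multilinear substitution as linear substitution -/

-- With no resource left, any occurrence of the only linear variable annihilates the result; for
-- `linZero` this is the effect of `Expr.substZero`.
open Classical in
theorem Expr.linSubst_zero {κ : Kind} (e : Expr κ) :
    ∀ (f : ℕ → Option ℕ) (p : ℕ → ℕ) (k : ℕ), f k = none → (∀ j, j ≠ k → f j = some (p j)) →
      e.linSubst f 0 = if k ∈ e.fv then 0 else {e.rename p} := by
  induction e using Expr.ind with
  | var n =>
    intro f p k hk h
    by_cases hn : n = k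
    · subst hn; rw [linSubst_var_none hk]; simp
    · rw [linSubst_var_some (h n hn)]; simp [Ne.symm hn]
  | lam s ih =>
    intro f p k hk h
    rw [linSubst_lam, Multiset.map_zero, ih (liftLin f) (liftRen p) (k + 1) (by simp [liftLin, hk])]
    · simp only [fv_lam, Set.mem_ofPred_eq]
      split_ifs <;> simp
    · intro j hj
      cases j with
      | zero => rfl
      | succ j => simp [liftLin, liftRen, h j (by omega)]
  | app s t ih₁ ih₂ =>
    intro f p k hk h
    rw [linSubst_app, split_zero, ih₁ f p k hk h, ih₂ f p k hk h]
    by_cases h₁ : k ∈ s.fv <;> by_cases h₂ : k ∈ t.fv <;> simp [h₁, h₂]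
  | nil => intro f p k hk h; rw [linSubst_nil]; simp
  | cons s t ih₁ ih₂ =>
    intro f p k hk h
    rw [linSubst_cons, split_zero, ih₁ f p k hk h, ih₂ f p k hk h]
    by_cases h₁ : k ∈ s.fv <;> by_cases h₂ : k ∈ t.fv <;> simp [h₁, h₂]

theorem Expr.pdiff_var (x : ℕ) (u : Expr Kind.tm) (n : ℕ) :
    Expr.pdiff x u (Expr.var n) = if n = x then {u} else 0 := rfl

theorem Expr.pdiff_nil (x : ℕ) (u : Expr Kind.tm) : Expr.pdiff x u Expr.nil = 0 := rfl

theorem bind_linSubst_lamSum (σ : Multiset (Expr Kind.tm)) (f : ℕ → Option ℕ)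
    (m : Multiset (Expr Kind.tm)) :
    (lamSum σ).bind (Expr.linSubst f m)
      = lamSum (σ.bind (Expr.linSubst (liftLin f) (m.map Expr.shift))) := by
  simp [lamSum, Multiset.bind_map, Multiset.map_bind, Expr.linSubst_lam]

/-- The resource `u` must land on exactly one occurrence of `k`, and choosing that occurrence is
differentiating along `u`. The map `ι` brings `u` into the scope of `e`; since `f` undoes `ι`, the
later substitution of `m` leaves `u` as it was. -/
theorem Expr.linSubst_cons_eq {κ : Kind} (e : Expr κ) :
    ∀ (f : ℕ → Option ℕ) (ι : ℕ → ℕ) (k : ℕ) (u : Expr Kind.tm) (m : Multiset (Expr Kind.tm)),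
      f k = none → (∀ j, j ≠ k → (f j).isSome) → (∀ n, f (ι n) = some n) →
      e.linSubst f (u ::ₘ m) = (Expr.pdiff k (u.rename ι) e).bind (Expr.linSubst f m) := by
  induction e using Expr.ind with
  | var n =>
    intro f ι k u m hk hs hι
    rw [pdiff_var]
    split_ifs with hn
    · subst hn
      -- The inserted copy of `u` has no linear variable, so it can absorb none of the remaining
      -- resources: `m` must be empty.
      have : f ∘ ι = fun n => some (id n) := funext hι
      rw [linSubst_var_none hk, Multiset.singleton_bind, linSubst_rename, this, linSubst_of_some]
      rw [rename_id]
      by_cases hm : m = 0 <;> simp [hm]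
    · obtain ⟨j, hj⟩ := Option.isSome_iff_exists.1 (hs n hn)
      rw [linSubst_var_some hj]
      simp
  | lam s ih =>
    intro f ι k u m hk hs hι
    rw [linSubst_lam, pdiff_lam, bind_linSubst_lamSum, Multiset.map_cons,
      ih (liftLin f) (liftRen ι) (k + 1) _ _ (by simp [liftLin, hk]), rename_shift]
    · intro j hj
      cases j with
      | zero => rfl
      | succ j => simpa [liftLin] using hs j (by omega)
    · intro n
      cases n with
      | zero => rfl
      | succ n => simp [liftLin, liftRen, hι]
  | app s t ih₁ ih₂ =>
    intro f ι k u m hk hs hι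
    rw [linSubst_app, split_cons, pdiff_app, Multiset.add_bind, add_comm, Multiset.bind_map,
      Multiset.bind_map]
    simp only [linSubst_app, bind_split]
    congr 1
    · refine split_congr fun x y _ => ?_
      rw [ih₁ f ι k u x hk hs hι, appSum_bind_left]
    · refine split_congr fun x y _ => ?_
      rw [ih₂ f ι k u y hk hs hι, appSum_bind_right]
  | nil => intro f ι k u m hk hs hι; rw [linSubst_nil, pdiff_nil]; simp
  | cons s t ih₁ ih₂ =>
    intro f ι k u m hk hs hι
    rw [linSubst_cons, split_cons, pdiff_cons, Multiset.add_bind, add_comm, Multiset.bind_map,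
      Multiset.bind_map]
    simp only [linSubst_cons, bind_split]
    congr 1
    · refine split_congr fun x y _ => ?_
      rw [ih₁ f ι k u x hk hs hι, consSum_bind_left]
    · refine split_congr fun x y _ => ?_
      rw [ih₂ f ι k u y hk hs hι, consSum_bind_right]

/-- The assignment in which `0` is the only linear variable. -/
def linZero : ℕ → Option ℕ
  | 0 => none
  | n + 1 => some n

theorem bind_substZero_foldr_diffStep {κ : Kind} (m : Multiset (Expr Kind.tm)) :
    ∀ ε : Multiset (Expr κ),
      (m.foldr diffStep ε).bind Expr.substZero = ε.bind (Expr.linSubst linZero m) := by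
  induction m using Multiset.induction with
  | empty =>
    intro ε
    refine Multiset.bind_congr fun e _ => ?_
    rw [Expr.linSubst_zero e linZero Nat.pred 0 rfl, Expr.substZero, Expr.unshift]
    intro j hj
    cases j with
    | zero => exact absurd rfl hj
    | succ j => rfl
  | cons u m ih =>
    intro ε
    -- The fold differentiates along `u` last, whereas `Expr.linSubst_cons_eq` needs it first;
    -- derivatives commute.
    have comm : ∀ m : Multiset (Expr Kind.tm),
        diffStep u (m.foldr diffStep ε) = m.foldr diffStep (diffStep u ε) := by
      intro m
      induction m using Multiset.induction with
      | empty => rfl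
      | cons v m ih =>
        rw [Multiset.foldr_cons, Multiset.foldr_cons, ← ih]
        exact LeftCommutative.left_comm ..
    rw [Multiset.foldr_cons, comm, ih, diffStep, Multiset.bind_assoc]
    refine Multiset.bind_congr fun e _ => ?_
    rw [Expr.linSubst_cons_eq e linZero Nat.succ 0 u m rfl _ fun _ => rfl]
    · rfl
    · intro j hj
      cases j with
      | zero => exact absurd rfl hj
      | succ j => rfl

theorem Expr.lsubst_eq {κ : Kind} (e : Expr κ) (t : Expr Kind.mon) :
    e.lsubst t = e.linSubst linZero t.elems := by
  rw [Expr.lsubst, Expr.npdiff, bind_substZero_foldr_diffStep, Multiset.singleton_bind]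

/-! ### Composition of linear substitutions -/

theorem Expr.rename_ofMultiset (f : ℕ → ℕ) (m : Multiset (Expr Kind.tm)) :
    (Expr.ofMultiset m).rename f = Expr.ofMultiset (m.map (Expr.rename f)) := by
  induction m using Multiset.induction with
  | empty => rfl
  | cons a m ih => simp [ih]

/-- Substitution in a monomial acts factor by factor. Hence the cardinality tests made at variables
have the same outcome before and after substituting in the resources. -/
theorem Expr.card_elems_of_mem_linSubst (r : Multiset (Expr Kind.tm)) (g : ℕ → Option ℕ) :
    ∀ (m : Multiset (Expr Kind.tm)), ∀ r' ∈ (Expr.ofMultiset r).linSubst g m,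
      r'.elems.card = r.card := by
  induction r using Multiset.induction with
  | empty =>
    intro m r' h
    rw [ofMultiset_zero, linSubst_nil] at h
    split_ifs at h
    · rw [Multiset.mem_singleton.1 h]; rfl
    · simp at h
  | cons a r ih =>
    intro m r' h
    rw [ofMultiset_cons, linSubst_cons, mem_split] at h
    obtain ⟨x, y, -, h⟩ := h
    obtain ⟨a', -, r₁, h₁, rfl⟩ := mem_consSum.1 h
    simp [ih y r₁ h₁]

open Classical in
theorem bind_linSubst_ite_elems_eq_zero {α : Type*} (r : Multiset (Expr Kind.tm))
    (g : ℕ → Option ℕ) (m : Multiset (Expr Kind.tm)) (A : Multiset α) :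
    (((Expr.ofMultiset r).linSubst g m).bind fun r' => if r'.elems = 0 then A else 0)
      = if r = 0 then if m = 0 then A else 0 else 0 := by
  by_cases hr : r = 0
  · subst hr
    rw [Expr.ofMultiset_zero, Expr.linSubst_nil, if_pos rfl]
    split_ifs <;> simp
  · have h : ∀ r' ∈ (Expr.ofMultiset r).linSubst g m,
        (if r'.elems = 0 then A else 0) = 0 := by
      intro r' hr'
      have hc := Expr.card_elems_of_mem_linSubst r g m r' hr'
      rw [if_neg]
      intro h0
      rw [h0, Multiset.card_zero] at hc
      exact hr (Multiset.card_eq_zero.1 hc.symm)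
    rw [Multiset.bind_congr h]
    simp [hr]

open Classical in
theorem bind_linSubst_ite_card_elems_eq_one (r : Multiset (Expr Kind.tm))
    (g : ℕ → Option ℕ) (m : Multiset (Expr Kind.tm)) :
    (((Expr.ofMultiset r).linSubst g m).bind fun r' => if r'.elems.card = 1 then r'.elems else 0)
      = (if r.card = 1 then r else 0).bind (Expr.linSubst g m) := by
  by_cases hr : r.card = 1
  · obtain ⟨a, rfl⟩ := Multiset.card_eq_one.1 hr
    have h : ({a} : Multiset (Expr Kind.tm)) = a ::ₘ 0 := rfl
    rw [if_pos hr, Multiset.singleton_bind, h, Expr.ofMultiset_cons, Expr.linSubst_cons, split_bind]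
    rw [← split_ite_right m fun x => Expr.linSubst g x a]
    refine split_congr fun x y _ => ?_
    rw [Expr.ofMultiset_zero, Expr.linSubst_nil]
    split_ifs
    · simpa [consSum, Multiset.bind_map] using Multiset.bind_singleton (Expr.linSubst g x a) id
    · simp
  · have h : ∀ r' ∈ (Expr.ofMultiset r).linSubst g m,
        (if r'.elems.card = 1 then r'.elems else 0) = 0 := by
      intro r' hr'
      rw [if_neg (by rwa [Expr.card_elems_of_mem_linSubst r g m r' hr'])]
    rw [Multiset.bind_congr h]
    simp [hr]

/-- Linear substitution in a monomial commutes with the splittings of monomials. -/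
theorem bind_linSubst_split {α : Type*} (g : ℕ → Option ℕ) (r : Multiset (Expr Kind.tm)) :
    ∀ (m : Multiset (Expr Kind.tm))
      (G : Multiset (Expr Kind.tm) → Multiset (Expr Kind.tm) → Multiset α),
      (((Expr.ofMultiset r).linSubst g m).bind fun r' => split r'.elems G)
        = split r fun p q => split m fun x y => ((Expr.ofMultiset p).linSubst g x).bind fun p' =>
            ((Expr.ofMultiset q).linSubst g y).bind fun q' => G p'.elems q'.elems := by
  classical
  induction r using Multiset.induction with
  | empty =>
    intro m G
    rw [split_zero, Expr.ofMultiset_zero]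
    simp only [Expr.linSubst_nil]
    rw [show (if m = 0 then ({Expr.nil} : Multiset (Expr Kind.mon)) else 0).bind
        (fun r' => split r'.elems G) = if m = 0 then G 0 0 else 0 by split_ifs <;> simp]
    rw [← split_ite_left m fun y => if y = 0 then G 0 0 else 0]
    refine split_congr fun x y _ => ?_
    split_ifs <;> simp
  | cons a r ih =>
    intro m G
    rw [Expr.ofMultiset_cons, Expr.linSubst_cons, split_bind, split_cons]
    have h (x y : Multiset (Expr Kind.tm)) :
        ((consSum (a.linSubst g x) ((Expr.ofMultiset r).linSubst g y)).bind
          fun r' => split r'.elems G)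
        = (split r fun p q => split y fun z w =>
            (a.linSubst g x).bind fun a' => ((Expr.ofMultiset p).linSubst g z).bind fun p' =>
            ((Expr.ofMultiset q).linSubst g w).bind fun q' => G p'.elems (a' ::ₘ q'.elems))
          + split r fun p q => split y fun z w =>
            (a.linSubst g x).bind fun a' => ((Expr.ofMultiset p).linSubst g z).bind fun p' =>
            ((Expr.ofMultiset q).linSubst g w).bind fun q' => G (a' ::ₘ p'.elems) q'.elems := by
      simp only [consSum, Multiset.bind_assoc, Multiset.bind_map, Expr.elems_cons, split_cons,
        Multiset.bind_add, ih, bind_split]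
    simp only [h, split_add, split_split m]
    congr 1
    · refine split_congr fun p q _ => ?_
      -- Here `a` has joined the second part, so its share of `m` is grouped with that of `q`; in
      -- the other summand `split_assoc` groups it with that of `p`.
      rw [split_left_comm]
      refine split_congr fun x y _ => ?_
      rw [Expr.ofMultiset_cons, Expr.linSubst_cons]
      simp only [split_bind, bind_split]
      refine split_congr fun z w _ => ?_
      rw [Multiset.bind_bind]
      simp [consSum, Multiset.bind_assoc, Multiset.bind_map]
    · refine split_congr fun p q _ => ?_
      rw [split_assoc]
      refine split_congr fun x y _ => ?_
      rw [Expr.ofMultiset_cons, Expr.linSubst_cons]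
      simp only [split_bind]
      refine split_congr fun z w _ => ?_
      simp [consSum, Multiset.bind_assoc, Multiset.bind_map]

/-- The step of `Expr.linSubst_linSubst` common to `app` and `cons` nodes: the shares of `m` that go
to the two children and to their two parts of `r` are regrouped child by child, by `split_exchange`.
-/
theorem split_bind_linSubst_split {α β γ : Type*} (g : ℕ → Option ℕ)
    (r m : Multiset (Expr Kind.tm)) (A : Multiset (Expr Kind.tm) → Multiset α)
    (C : Multiset (Expr Kind.tm) → Multiset β)
    (G : α → Multiset (Expr Kind.tm) → β → Multiset (Expr Kind.tm) → Multiset γ) :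
    (split m fun x y => split x fun a c => (A a).bind fun s => (C c).bind fun t =>
        ((Expr.ofMultiset r).linSubst g y).bind fun r' => split r'.elems fun p q => G s p t q)
      = split r fun p q => split m fun x y => split x fun a b => split y fun c d =>
        (A a).bind fun s => ((Expr.ofMultiset p).linSubst g b).bind fun p' =>
        (C c).bind fun t => ((Expr.ofMultiset q).linSubst g d).bind fun q' =>
          G s p'.elems t q'.elems := by
  simp only [bind_linSubst_split, bind_split, split_split _ r]
  refine split_congr fun p q _ => ?_
  rw [split_exchange]
  refine split_congr fun x y _ => split_congr fun a c _ => split_congr fun b d _ => ?_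
  refine Multiset.bind_congr fun s _ => ?_
  rw [Multiset.bind_bind]

theorem bind_linSubst_appSum (σ : Multiset (Expr Kind.tm)) (τ : Multiset (Expr Kind.mon))
    (g : ℕ → Option ℕ) (m : Multiset (Expr Kind.tm)) :
    (appSum σ τ).bind (Expr.linSubst g m)
      = split m fun x y => appSum (σ.bind (Expr.linSubst g x)) (τ.bind (Expr.linSubst g y)) := by
  simp only [appSum_bind_left]
  simp only [appSum, Multiset.bind_assoc, Multiset.bind_map, Expr.linSubst_app, bind_split]
  refine split_congr fun x y _ => Multiset.bind_congr fun s' _ => ?_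
  exact (appSum_bind_right _ _ _).symm

theorem bind_linSubst_consSum (σ : Multiset (Expr Kind.tm)) (τ : Multiset (Expr Kind.mon))
    (g : ℕ → Option ℕ) (m : Multiset (Expr Kind.tm)) :
    (consSum σ τ).bind (Expr.linSubst g m)
      = split m fun x y => consSum (σ.bind (Expr.linSubst g x)) (τ.bind (Expr.linSubst g y)) := by
  simp only [consSum_bind_left]
  simp only [consSum, Multiset.bind_assoc, Multiset.bind_map, Expr.linSubst_cons, bind_split]
  refine split_congr fun x y _ => Multiset.bind_congr fun s' _ => ?_
  exact (consSum_bind_right _ _ _).symm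

/-- Each resource in `m` ends up either in `e` itself or inside one of the resources in `r`, hence
the outer splitting; `r` is treated as a monomial so that `m` can be distributed among its elements.
The assignments `g'` and `f'` perform the two substitutions in the opposite order: variables linear
for `f` survive `g'` and become linear for `f'`. The map `ι` brings `m` into the intermediate scope,
and `f'` undoes it. -/
theorem Expr.linSubst_linSubst {κ : Kind} (e : Expr κ) :
    ∀ (f g f' g' : ℕ → Option ℕ) (ι : ℕ → ℕ), (∀ n, f' (ι n) = some n) →
      (∀ n, f n = none → ∃ p, g' n = some p ∧ f' p = none) →
      (∀ n k, f n = some k → g k = none → g' n = none) →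
      (∀ n k l, f n = some k → g k = some l → ∃ p, g' n = some p ∧ f' p = some l) →
      ∀ r m : Multiset (Expr Kind.tm),
        (e.linSubst f r).bind (Expr.linSubst g m)
          = split m fun x y => (e.linSubst g' (x.map (Expr.rename ι))).bind fun e' =>
              ((Expr.ofMultiset r).linSubst g y).bind fun r' => e'.linSubst f' r'.elems := by
  classical
  induction e using Expr.ind with
  | var n =>
    intro f g f' g' ι hι h₁ h₂ h₃ r m
    cases hf : f n with
    | none =>
      obtain ⟨p, hp, hp'⟩ := h₁ n hf
      rw [linSubst_var_none hf, ← bind_linSubst_ite_card_elems_eq_one,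
        ← split_ite_left m fun m => ((Expr.ofMultiset r).linSubst g m).bind fun r' =>
          if r'.elems.card = 1 then r'.elems else 0]
      refine split_congr fun x y _ => ?_
      rw [linSubst_var_some hp]
      simp only [Multiset.map_eq_zero]
      split_ifs
      · rw [Multiset.singleton_bind]
        exact Multiset.bind_congr fun r' _ => (linSubst_var_none hp' _).symm
      · simp
    | some k =>
      rw [linSubst_var_some hf]
      cases hg : g k with
      | none =>
        -- The variable receives its resource from `m`. As `f' ∘ ι` has no linear variable, nothing
        -- is left to absorb elements of `r`, so both sides vanish unless `r = 0`.
        have hg' := h₂ n k hf hg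
        have hf' : f' ∘ ι = fun n => some (id n) := funext hι
        have h (x y : Multiset (Expr Kind.tm)) :
            (((Expr.var n).linSubst g' (x.map (Expr.rename ι))).bind fun e' =>
              ((Expr.ofMultiset r).linSubst g y).bind fun r' => e'.linSubst f' r'.elems)
            = if y = 0 then (if r = 0 then (if x.card = 1 then x else 0) else 0) else 0 := by
          rw [linSubst_var_none hg', Multiset.card_map]
          by_cases hx : x.card = 1
          · obtain ⟨v, rfl⟩ := Multiset.card_eq_one.1 hx
            simp only [Multiset.card_singleton, Multiset.map_singleton, if_true,
              Multiset.singleton_bind, linSubst_rename, hf', linSubst_of_some, rename_id,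
              bind_linSubst_ite_elems_eq_zero]
            split_ifs <;> rfl
          · simp [hx]
        simp only [h]
        rw [split_ite_right m fun x => if r = 0 then (if x.card = 1 then x else 0) else 0]
        split_ifs with hr hm
        · simp [linSubst_var_none hg, hm]
        · simp [linSubst_var_none hg, hm]
        · simp
      | some l =>
        obtain ⟨p, hp, hp'⟩ := h₃ n k l hf hg
        have h (x y : Multiset (Expr Kind.tm)) :
            (((Expr.var n).linSubst g' (x.map (Expr.rename ι))).bind fun e' =>
              ((Expr.ofMultiset r).linSubst g y).bind fun r' => e'.linSubst f' r'.elems)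
            = if x = 0 then (if r = 0 then (if y = 0 then {Expr.var l} else 0) else 0) else 0 := by
          rw [linSubst_var_some hp]
          simp only [Multiset.map_eq_zero]
          by_cases hx : x = 0
          · rw [if_pos hx, if_pos hx, Multiset.singleton_bind]
            simp only [linSubst_var_some hp']
            exact bind_linSubst_ite_elems_eq_zero ..
          · simp [hx]
        simp only [h]
        rw [split_ite_left m fun y => if r = 0 then (if y = 0 then {Expr.var l} else 0) else 0]
        split_ifs with hr hm
        · simp [linSubst_var_some hg, hm]
        · simp [linSubst_var_some hg, hm]
        · simp
  | lam s ih =>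
    intro f g f' g' ι hι h₁ h₂ h₃ r m
    rw [linSubst_lam, bind_linSubst_lamSum,
      ih (liftLin f) (liftLin g) (liftLin f') (liftLin g') (liftRen ι), split_map, lamSum, map_split]
    · refine split_congr fun x y _ => ?_
      -- The elements of `r` and `y` come from outside the binder, so substituting under it is
      -- substituting outside and then shifting.
      have hr : (Expr.ofMultiset (r.map Expr.shift)).linSubst (liftLin g) (y.map Expr.shift)
          = ((Expr.ofMultiset r).linSubst g y).map Expr.shift := by
        have := Expr.rename_ofMultiset Nat.succ r
        rw [show r.map Expr.shift = r.map (Expr.rename Nat.succ) from rfl, ← this,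
          linSubst_rename]
        exact (rename_linSubst (Expr.ofMultiset r) g Nat.succ y).symm
      have hs (r' : Expr Kind.mon) : r'.shift.elems = r'.elems.map Expr.shift :=
        Expr.elems_rename Nat.succ r'
      simp only [linSubst_lam, hr, lamSum, Multiset.bind_map, Multiset.map_bind, hs,
        Multiset.map_map, Function.comp_def, rename_shift]
    · intro n
      cases n with
      | zero => rfl
      | succ n => simp [liftLin, liftRen, hι]
    · intro n hn
      cases n with
      | zero => simp [liftLin] at hn
      | succ n =>
        obtain ⟨p, hp, hp'⟩ := h₁ n (by simpa [liftLin] using hn)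
        exact ⟨p + 1, by simp [liftLin, hp], by simp [liftLin, hp']⟩
    · intro n k hn hk
      cases n with
      | zero =>
        obtain rfl : 0 = k := by simpa [liftLin] using hn
        simp [liftLin] at hk
      | succ n =>
        obtain ⟨k', hk', rfl⟩ : ∃ k', f n = some k' ∧ k' + 1 = k := by simpa [liftLin] using hn
        simpa [liftLin] using h₂ n k' hk' (by simpa [liftLin] using hk)
    · intro n k l hn hk
      cases n with
      | zero =>
        obtain rfl : 0 = k := by simpa [liftLin] using hn
        obtain rfl : 0 = l := by simpa [liftLin] using hk
        exact ⟨0, rfl, rfl⟩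
      | succ n =>
        obtain ⟨k', hk', rfl⟩ : ∃ k', f n = some k' ∧ k' + 1 = k := by simpa [liftLin] using hn
        obtain ⟨l', hl', rfl⟩ : ∃ l', g k' = some l' ∧ l' + 1 = l := by simpa [liftLin] using hk
        obtain ⟨p, hp, hp'⟩ := h₃ n k' l' hk' hl'
        exact ⟨p + 1, by simp [liftLin, hp], by simp [liftLin, hp']⟩
  | app s t ih₁ ih₂ =>
    intro f g f' g' ι hι h₁ h₂ h₃ r m
    have hR (x y : Multiset (Expr Kind.tm)) :
        (((Expr.app s t).linSubst g' (x.map (Expr.rename ι))).bind fun e' =>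
          ((Expr.ofMultiset r).linSubst g y).bind fun r' => e'.linSubst f' r'.elems)
        = split x fun a c => (s.linSubst g' (a.map (Expr.rename ι))).bind fun s' =>
            (t.linSubst g' (c.map (Expr.rename ι))).bind fun t' =>
            ((Expr.ofMultiset r).linSubst g y).bind fun r' => split r'.elems fun p q =>
              appSum (s'.linSubst f' p) (t'.linSubst f' q) := by
      simp only [linSubst_app, split_map, split_bind]
      simp only [appSum, Multiset.bind_assoc, Multiset.bind_map, linSubst_app]
    rw [linSubst_app, split_bind]
    simp only [bind_linSubst_appSum, hR]
    rw [split_bind_linSubst_split g r m (fun a => s.linSubst g' (a.map (Expr.rename ι)))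
      (fun c => t.linSubst g' (c.map (Expr.rename ι)))
      fun s' p t' q => appSum (s'.linSubst f' p) (t'.linSubst f' q)]
    refine split_congr fun p q _ => split_congr fun x y _ => ?_
    rw [ih₁ f g f' g' ι hι h₁ h₂ h₃, ih₂ f g f' g' ι hι h₁ h₂ h₃]
    rw [appSum_split_left]
    refine split_congr fun a b _ => ?_
    rw [appSum_split_right]
    refine split_congr fun c d _ => ?_
    simp only [appSum_bind_left]
    simp only [appSum_bind_right]
  | nil =>
    intro f g f' g' ι hι h₁ h₂ h₃ r m
    have h (x y : Multiset (Expr Kind.tm)) :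
        ((Expr.nil.linSubst g' (x.map (Expr.rename ι))).bind fun e' =>
          ((Expr.ofMultiset r).linSubst g y).bind fun r' => e'.linSubst f' r'.elems)
        = if x = 0 then (if r = 0 then (if y = 0 then {Expr.nil} else 0) else 0) else 0 := by
      rw [linSubst_nil]
      simp only [Multiset.map_eq_zero]
      by_cases hx : x = 0
      · rw [if_pos hx, if_pos hx, Multiset.singleton_bind]
        simp only [linSubst_nil]
        exact bind_linSubst_ite_elems_eq_zero ..
      · simp [hx]
    simp only [h]
    rw [split_ite_left m fun y => if r = 0 then (if y = 0 then {Expr.nil} else 0) else 0]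
    rw [linSubst_nil]
    split_ifs with hr hm
    · simp [linSubst_nil, hm]
    · simp [linSubst_nil, hm]
    · simp
  | cons s t ih₁ ih₂ =>
    intro f g f' g' ι hι h₁ h₂ h₃ r m
    have hR (x y : Multiset (Expr Kind.tm)) :
        (((Expr.cons s t).linSubst g' (x.map (Expr.rename ι))).bind fun e' =>
          ((Expr.ofMultiset r).linSubst g y).bind fun r' => e'.linSubst f' r'.elems)
        = split x fun a c => (s.linSubst g' (a.map (Expr.rename ι))).bind fun s' =>
            (t.linSubst g' (c.map (Expr.rename ι))).bind fun t' =>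
            ((Expr.ofMultiset r).linSubst g y).bind fun r' => split r'.elems fun p q =>
              consSum (s'.linSubst f' p) (t'.linSubst f' q) := by
      simp only [linSubst_cons, split_map, split_bind]
      simp only [consSum, Multiset.bind_assoc, Multiset.bind_map, linSubst_cons]
    rw [linSubst_cons, split_bind]
    simp only [bind_linSubst_consSum, hR]
    rw [split_bind_linSubst_split g r m (fun a => s.linSubst g' (a.map (Expr.rename ι)))
      (fun c => t.linSubst g' (c.map (Expr.rename ι)))
      fun s' p t' q => consSum (s'.linSubst f' p) (t'.linSubst f' q)]
    refine split_congr fun p q _ => split_congr fun x y _ => ?_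
    rw [ih₁ f g f' g' ι hι h₁ h₂ h₃, ih₂ f g f' g' ι hι h₁ h₂ h₃]
    rw [consSum_split_left]
    refine split_congr fun a b _ => ?_
    rw [consSum_split_right]
    refine split_congr fun c d _ => ?_
    simp only [consSum_bind_left]
    simp only [consSum_bind_right]

/-! ### Parallel reduction of sums -/

theorem ParRed.refl {κ : Kind} (e : Expr κ) : ParRed e {e} := by
  induction e using Expr.ind with
  | var n => exact ParRed.var n
  | lam s ih => simpa using ParRed.lam ih
  | app s t ih₁ ih₂ => simpa using ParRed.app ih₁ ih₂
  | nil => exact ParRed.nil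
  | cons s t ih₁ ih₂ => simpa using ParRed.cons ih₁ ih₂

theorem map_rename_lsubstSum {κ : Kind} (f : ℕ → ℕ) (σ : Multiset (Expr κ))
    (τ : Multiset (Expr Kind.mon)) :
    (lsubstSum σ τ).map (Expr.rename f)
      = lsubstSum (σ.map (Expr.rename (liftRen f))) (τ.map (Expr.rename f)) := by
  have h : linZero ∘ liftRen f = fun n => (linZero n).map f := by funext n; cases n <;> rfl
  simp only [lsubstSum, Multiset.map_bind, Multiset.bind_map, Expr.lsubst_eq,
    Expr.rename_linSubst, Expr.linSubst_rename, Expr.elems_rename, h]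

/-- Resources are shifted when they pass under a binder, and their reductions must follow. -/
theorem ParRed.rename {κ : Kind} {e : Expr κ} {φ : Multiset (Expr κ)} (h : ParRed e φ) :
    ∀ f : ℕ → ℕ, ParRed (e.rename f) (φ.map (Expr.rename f)) := by
  induction h with
  | var n => exact fun f => ParRed.var _
  | redex _ _ ih₁ ih₂ =>
    intro f
    simpa [map_rename_lsubstSum] using ParRed.redex (ih₁ (liftRen f)) (ih₂ f)
  | lam _ ih => intro f; simpa [map_rename_lamSum] using ParRed.lam (ih (liftRen f))
  | app _ _ ih₁ ih₂ => intro f; simpa [map_rename_appSum] using ParRed.app (ih₁ f) (ih₂ f)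
  | nil => exact fun f => ParRed.nil
  | cons _ _ ih₁ ih₂ => intro f; simpa [map_rename_consSum] using ParRed.cons (ih₁ f) (ih₂ f)

/-- Parallel reduction of finite sums, summand by summand. -/
inductive SumRed {κ : Kind} : Multiset (Expr κ) → Multiset (Expr κ) → Prop
  | zero : SumRed 0 0
  | cons {e : Expr κ} {φ σ σ' : Multiset (Expr κ)} :
      ParRed e φ → SumRed σ σ' → SumRed (e ::ₘ σ) (φ + σ')

namespace SumRed

variable {κ κ' : Kind}

theorem single {e : Expr κ} {φ : Multiset (Expr κ)} (h : ParRed e φ) : SumRed {e} φ := by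
  simpa using SumRed.cons h SumRed.zero

theorem add {σ σ' τ τ' : Multiset (Expr κ)} (h : SumRed σ σ') (k : SumRed τ τ') :
    SumRed (σ + τ) (σ' + τ') := by
  induction h with
  | zero => simpa using k
  | cons h _ ih => rw [Multiset.cons_add, add_assoc]; exact SumRed.cons h ih

theorem bind {σ σ' : Multiset (Expr κ)} (h : SumRed σ σ') {f g : Expr κ → Multiset (Expr κ')}
    (hf : ∀ e φ, ParRed e φ → SumRed (f e) (φ.bind g)) : SumRed (σ.bind f) (σ'.bind g) := by
  induction h with
  | zero => exact SumRed.zero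
  | cons h _ ih => rw [Multiset.cons_bind, Multiset.add_bind]; exact (hf _ _ h).add ih

/-- All the bilinear constructions are handled through this: compatibility with reduction need only
be checked on pairs of expressions. Reordering the nested sums allows one argument to be treated at
a time. -/
theorem bind₂ {κ₁ κ₂ : Kind} {σ σ' : Multiset (Expr κ₁)} {τ τ' : Multiset (Expr κ₂)}
    (h : SumRed σ σ') (k : SumRed τ τ') {f g : Expr κ₁ → Expr κ₂ → Multiset (Expr κ)}
    (hf : ∀ s φ t ψ, ParRed s φ → ParRed t ψ →
      SumRed (f s t) (φ.bind fun s' => ψ.bind fun t' => g s' t')) :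
    SumRed (σ.bind fun s => τ.bind fun t => f s t)
      (σ'.bind fun s => τ'.bind fun t => g s t) := by
  refine h.bind fun s φ hs => ?_
  rw [Multiset.bind_bind]
  refine k.bind fun t ψ ht => ?_
  rw [Multiset.bind_bind]
  exact hf s φ t ψ hs ht

theorem lam {σ σ' : Multiset (Expr Kind.tm)} (h : SumRed σ σ') :
    SumRed (lamSum σ) (lamSum σ') := by
  induction h with
  | zero => exact SumRed.zero
  | cons h _ ih =>
    simp only [lamSum, Multiset.map_cons, Multiset.map_add]
    exact SumRed.cons h.lam ih

theorem app {σ σ' : Multiset (Expr Kind.tm)} {τ τ' : Multiset (Expr Kind.mon)}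
    (h : SumRed σ σ') (k : SumRed τ τ') : SumRed (appSum σ τ) (appSum σ' τ') := by
  have e (σ : Multiset (Expr Kind.tm)) (τ : Multiset (Expr Kind.mon)) :
      appSum σ τ = σ.bind fun s => τ.bind fun t => {Expr.app s t} := by
    simp [appSum, Multiset.bind_singleton]
  rw [e, e]
  refine h.bind₂ k fun s φ t ψ hs ht => ?_
  rw [← e]
  exact single (hs.app ht)

theorem mon_cons {σ σ' : Multiset (Expr Kind.tm)} {τ τ' : Multiset (Expr Kind.mon)}
    (h : SumRed σ σ') (k : SumRed τ τ') : SumRed (consSum σ τ) (consSum σ' τ') := by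
  have e (σ : Multiset (Expr Kind.tm)) (τ : Multiset (Expr Kind.mon)) :
      consSum σ τ = σ.bind fun s => τ.bind fun t => {Expr.cons s t} := by
    simp [consSum, Multiset.bind_singleton]
  rw [e, e]
  refine h.bind₂ k fun s φ t ψ hs ht => ?_
  rw [← e]
  exact single (hs.cons ht)

theorem redex {σ σ' : Multiset (Expr Kind.tm)} {τ τ' : Multiset (Expr Kind.mon)}
    (h : SumRed σ σ') (k : SumRed τ τ') :
    SumRed (appSum (lamSum σ) τ) (lsubstSum σ' τ') := by
  have e : appSum (lamSum σ) τ = σ.bind fun s => τ.bind fun t => {Expr.app (Expr.lam s) t} := by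
    simp [appSum, lamSum, Multiset.bind_map, Multiset.bind_singleton]
  rw [e]
  exact h.bind₂ k fun s φ t ψ hs ht => single (hs.redex ht)

end SumRed

/-- Parallel reduction of the elements of a multiset of terms, extended multilinearly. -/
inductive MultiRed : Multiset (Expr Kind.tm) → Multiset (Multiset (Expr Kind.tm)) → Prop
  | zero : MultiRed 0 {0}
  | cons {s : Expr Kind.tm} {σ : Multiset (Expr Kind.tm)} {m : Multiset (Expr Kind.tm)}
      {M : Multiset (Multiset (Expr Kind.tm))} :
      ParRed s σ → MultiRed m M → MultiRed (s ::ₘ m) (σ.bind fun s' => M.map (s' ::ₘ ·))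

/-- Linear substitution takes a bare multiset of resources; this extracts their reductions from that
of the monomial holding them. -/
theorem ParRed.multiRed {t : Expr Kind.mon} {τ : Multiset (Expr Kind.mon)} (h : ParRed t τ) :
    MultiRed t.elems (τ.map Expr.elems) := by
  have key : ∀ {κ : Kind} {e : Expr κ} {φ : Multiset (Expr κ)}, ParRed e φ →
      ∀ hκ : κ = Kind.mon, MultiRed (hκ ▸ e : Expr Kind.mon).elems
        ((hκ ▸ φ : Multiset (Expr Kind.mon)).map Expr.elems) := by
    intro κ e φ h
    induction h with
    | var n => rintro ⟨⟩
    | redex _ _ _ _ => rintro ⟨⟩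
    | lam _ _ => rintro ⟨⟩
    | app _ _ _ _ => rintro ⟨⟩
    | nil => exact fun _ => MultiRed.zero
    | cons h _ _ ih =>
      intro _
      simpa [consSum, Multiset.map_bind, Multiset.map_map] using MultiRed.cons h (ih rfl)
  exact key h rfl

namespace MultiRed

variable {m : Multiset (Expr Kind.tm)} {M : Multiset (Multiset (Expr Kind.tm))}

theorem card_eq (h : MultiRed m M) : ∀ m' ∈ M, m'.card = m.card := by
  induction h with
  | zero => simp
  | cons _ _ ih =>
    intro m' hm'
    simp only [Multiset.mem_bind, Multiset.mem_map] at hm'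
    obtain ⟨s', -, n, hn, rfl⟩ := hm'
    simp [ih n hn]

theorem eq_of_zero (h : MultiRed m M) (hm : m = 0) : M = {0} := by
  cases h with
  | zero => rfl
  | cons _ _ => simp at hm

theorem map_rename (h : MultiRed m M) (f : ℕ → ℕ) :
    MultiRed (m.map (Expr.rename f)) (M.map (Multiset.map (Expr.rename f))) := by
  induction h with
  | zero => exact MultiRed.zero
  | cons h _ ih =>
    have := MultiRed.cons (h.rename f) ih
    simpa [Multiset.map_bind, Multiset.bind_map, Multiset.map_map] using this

open Classical in
theorem sumRed_ite_card (h : MultiRed m M) :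
    SumRed (if m.card = 1 then m else 0) (M.bind fun m' => if m'.card = 1 then m' else 0) := by
  by_cases hm : m.card = 1
  · rw [if_pos hm, Multiset.bind_congr fun m' hm' => if_pos ((h.card_eq m' hm').trans hm)]
    cases h with
    | zero => simp at hm
    | @cons s σ m M h₁ h₂ =>
      obtain rfl : m = 0 := by simpa using hm
      rw [h₂.eq_of_zero rfl]
      have : (σ.bind fun s' => ({0} : Multiset (Multiset (Expr Kind.tm))).map (s' ::ₘ ·)).bind
          (fun m' => m') = σ := by
        simpa [Multiset.bind_assoc, Multiset.bind_map] using Multiset.bind_singleton σ id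
      rw [this]
      exact SumRed.single h₁
  · rw [if_neg hm, Multiset.bind_congr fun m' hm' => if_neg (h.card_eq m' hm' ▸ hm)]
    simpa using SumRed.zero

open Classical in
theorem sumRed_ite_zero {κ : Kind} (h : MultiRed m M) {e : Expr κ} (he : ParRed e {e}) :
    SumRed (if m = 0 then {e} else 0) (M.bind fun m' => if m' = 0 then {e} else 0) := by
  by_cases hm : m = 0
  · rw [h.eq_of_zero hm, if_pos hm]
    simpa using SumRed.single he
  · have : ∀ m' ∈ M, (if m' = 0 then ({e} : Multiset (Expr κ)) else 0) = 0 := by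
      intro m' hm'
      rw [if_neg]
      rintro rfl
      exact hm (Multiset.card_eq_zero.1 (h.card_eq 0 hm').symm)
    rw [if_neg hm, Multiset.bind_congr this]
    simpa using SumRed.zero

/-- Elements reduce independently, so each carries its sum of reducts to whichever side of the
splitting it goes; splitting and reducing thus commute. -/
theorem sumRed_split {κ : Kind} (h : MultiRed m M) :
    ∀ {F G : Multiset (Expr Kind.tm) → Multiset (Expr Kind.tm) → Multiset (Expr κ)},
      (∀ x y X Y, MultiRed x X → MultiRed y Y →
        SumRed (F x y) (X.bind fun x' => Y.bind fun y' => G x' y')) →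
      SumRed (split m F) (M.bind fun m' => split m' G) := by
  induction h with
  | zero => intro F G hF; simpa using hF 0 0 _ _ MultiRed.zero MultiRed.zero
  | @cons a α m M h _ ih =>
    intro F G hF
    simp only [Multiset.bind_assoc, Multiset.bind_map, split_cons, Multiset.bind_add]
    refine SumRed.add ?_ ?_
    · rw [Multiset.bind_bind]
      simp only [bind_split]
      refine ih fun x y X Y hX hY => ?_
      have := hF x (a ::ₘ y) _ _ hX (hY.cons h)
      simp only [Multiset.bind_assoc, Multiset.bind_map] at this
      simpa only [Multiset.bind_bind Y α] using this
    · rw [Multiset.bind_bind]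
      simp only [bind_split]
      refine ih fun x y X Y hX hY => ?_
      have := hF (a ::ₘ x) y _ _ (hX.cons h) hY
      simp only [Multiset.bind_assoc, Multiset.bind_map] at this
      simp only [Multiset.bind_bind Y α]
      rwa [Multiset.bind_bind] at this

end MultiRed

/-! ### Parallel reduction passes through linear substitution -/

/-- This is `Expr.linSubst_linSubst` when the first substitution fires a redex. In the opposite
order, `liftLin f` acts under the binder and keeps the variable `0` for the final firing, and
`Nat.succ` moves the resources under the binder. -/
theorem bind_linSubst_lsubstSum {κ : Kind} (σ : Multiset (Expr κ)) (τ : Multiset (Expr Kind.mon))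
    (f : ℕ → Option ℕ) (m : Multiset (Expr Kind.tm)) :
    (lsubstSum σ τ).bind (Expr.linSubst f m)
      = split m fun x y => lsubstSum (σ.bind (Expr.linSubst (liftLin f) (x.map Expr.shift)))
          (τ.bind (Expr.linSubst f y)) := by
  have h (s : Expr κ) (t : Expr Kind.mon) : (s.lsubst t).bind (Expr.linSubst f m)
      = split m fun x y => (s.linSubst (liftLin f) (x.map Expr.shift)).bind fun s' =>
          (t.linSubst f y).bind fun t' => s'.lsubst t' := by
    simp only [Expr.lsubst_eq]
    rw [Expr.linSubst_linSubst s linZero f linZero (liftLin f) Nat.succ (fun _ => rfl),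
      Expr.ofMultiset_elems]
    · rfl
    · intro n hn
      cases n with
      | zero => exact ⟨0, rfl, rfl⟩
      | succ n => simp [linZero] at hn
    · intro n k hn hk
      cases n with
      | zero => simp [linZero] at hn
      | succ n =>
        obtain rfl : n = k := by simpa [linZero] using hn
        simp [liftLin, hk]
    · intro n k l hn hk
      cases n with
      | zero => simp [linZero] at hn
      | succ n =>
        obtain rfl : n = k := by simpa [linZero] using hn
        exact ⟨l + 1, by simp [liftLin, hk], rfl⟩
  simp only [lsubstSum, Multiset.bind_assoc, h, bind_split]
  refine split_congr fun x y _ => Multiset.bind_congr fun s _ => ?_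
  rw [Multiset.bind_bind]

theorem lsubstSum_bind_left {α : Type*} {κ : Kind} (σ : Multiset α) (f : α → Multiset (Expr κ))
    (τ : Multiset (Expr Kind.mon)) :
    lsubstSum (σ.bind f) τ = σ.bind fun a => lsubstSum (f a) τ := Multiset.bind_assoc ..

theorem lsubstSum_bind_right {α : Type*} {κ : Kind} (σ : Multiset (Expr κ)) (τ : Multiset α)
    (f : α → Multiset (Expr Kind.mon)) :
    lsubstSum σ (τ.bind f) = τ.bind fun a => lsubstSum σ (f a) := by
  simp only [lsubstSum, Multiset.bind_assoc]; rw [Multiset.bind_bind]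

/-- The substitution lemma for ⇉. In the redex case the substitution is moved inside the reduct by
`bind_linSubst_lsubstSum`; the induction hypotheses then treat body and arguments separately, and
the redex is fired by `SumRed.redex`. -/
theorem ParRed.linSubst {κ : Kind} {e : Expr κ} {φ : Multiset (Expr κ)} (h : ParRed e φ) :
    ∀ (f : ℕ → Option ℕ) {m : Multiset (Expr Kind.tm)} {M : Multiset (Multiset (Expr Kind.tm))},
      MultiRed m M → SumRed (e.linSubst f m) (M.bind fun m' => φ.bind (Expr.linSubst f m')) := by
  classical
  induction h with
  | var n =>
    intro f m M h
    cases hf : f n with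
    | none =>
      simp only [Multiset.singleton_bind, Expr.linSubst_var_none hf]
      exact h.sumRed_ite_card
    | some k =>
      simp only [Multiset.singleton_bind, Expr.linSubst_var_some hf]
      exact h.sumRed_ite_zero (ParRed.var k)
  | redex _ _ ih₁ ih₂ =>
    intro f m M h
    simp only [Expr.linSubst_app, bind_linSubst_lsubstSum]
    refine h.sumRed_split fun x y X Y hX hY => ?_
    have := SumRed.redex (ih₁ (liftLin f) (hX.map_rename Nat.succ)) (ih₂ f hY)
    rw [Multiset.bind_map] at this
    rw [lsubstSum_bind_left] at this
    simp only [lsubstSum_bind_right _ Y] at this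
    rw [Expr.linSubst_lam]
    exact this
  | lam _ ih =>
    intro f m M h
    simp only [Expr.linSubst_lam, bind_linSubst_lamSum]
    have := (ih (liftLin f) (h.map_rename Nat.succ)).lam
    rwa [Multiset.bind_map, lamSum, lamSum, Multiset.map_bind] at this
  | app _ _ ih₁ ih₂ =>
    intro f m M h
    simp only [Expr.linSubst_app, bind_linSubst_appSum]
    refine h.sumRed_split fun x y X Y hX hY => ?_
    simpa only [appSum_bind_left X, appSum_bind_right _ Y] using (ih₁ f hX).app (ih₂ f hY)
  | nil =>
    intro f m M h
    simp only [Multiset.singleton_bind, Expr.linSubst_nil]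
    exact h.sumRed_ite_zero ParRed.nil
  | cons _ _ ih₁ ih₂ =>
    intro f m M h
    simp only [Expr.linSubst_cons, bind_linSubst_consSum]
    refine h.sumRed_split fun x y X Y hX hY => ?_
    simpa only [consSum_bind_left X, consSum_bind_right _ Y] using (ih₁ f hX).mon_cons (ih₂ f hY)

theorem SumRed.lsubst {κ : Kind} {σ σ' : Multiset (Expr κ)} {τ τ' : Multiset (Expr Kind.mon)}
    (h : SumRed σ σ') (k : SumRed τ τ') : SumRed (lsubstSum σ τ) (lsubstSum σ' τ') := by
  refine h.bind₂ k fun s φ t ψ hs ht => ?_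
  have := hs.linSubst linZero ht.multiRed
  rw [Multiset.bind_map, Multiset.bind_bind] at this
  simpa only [Expr.lsubst_eq] using this

/-! ### Confluence on expressions -/

@[simp] theorem Expr.fullReduct_lam (s : Expr Kind.tm) :
    (Expr.lam s).fullReduct = lamSum s.fullReduct := by
  obtain ⟨s, rfl⟩ := s.mk_surj
  rfl

@[simp] theorem Expr.fullReduct_redex (s : Expr Kind.tm) (t : Expr Kind.mon) :
    (Expr.app (Expr.lam s) t).fullReduct = lsubstSum s.fullReduct t.fullReduct := by
  obtain ⟨s, rfl⟩ := s.mk_surj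
  obtain ⟨t, rfl⟩ := t.mk_surj
  exact Raw.fullReduct.eq_3 s t

theorem Expr.fullReduct_app (s : Expr Kind.tm) (t : Expr Kind.mon) (h : ∀ r, s ≠ Expr.lam r) :
    (Expr.app s t).fullReduct = appSum s.fullReduct t.fullReduct := by
  obtain ⟨s, rfl⟩ := s.mk_surj
  obtain ⟨t, rfl⟩ := t.mk_surj
  refine Raw.fullReduct_app_of_body s t ?_
  cases hs : s.body with
  | none => rfl
  | some b =>
    obtain ⟨r, rfl⟩ := Raw.exists_lam_of_body s b hs
    exact absurd rfl (h (Expr.mk r))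

@[simp] theorem Expr.fullReduct_cons (s : Expr Kind.tm) (t : Expr Kind.mon) :
    (Expr.cons s t).fullReduct = consSum s.fullReduct t.fullReduct := by
  obtain ⟨s, rfl⟩ := s.mk_surj
  obtain ⟨t, rfl⟩ := t.mk_surj
  rfl

/-- The body of an abstraction. -/
def Expr.body {κ : Kind} (e : Expr κ) : Option (Expr Kind.tm) :=
  Quotient.liftOn e Raw.body fun _ _ h => Raw.body_congr h

@[simp] theorem Expr.body_lam (s : Expr Kind.tm) : (Expr.lam s).body = some s := by
  obtain ⟨s, rfl⟩ := s.mk_surj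
  rfl

@[simp] theorem Expr.body_app (s : Expr Kind.tm) (t : Expr Kind.mon) :
    (Expr.app s t).body = none := by
  obtain ⟨s, rfl⟩ := s.mk_surj
  obtain ⟨t, rfl⟩ := t.mk_surj
  rfl

/-- Expressions form a quotient, so `Expr.lam` is not a constructor on which to invert; the
invariant `body` excludes the other rules. Heterogeneous equality is needed because the sort varies
in the induction. -/
theorem ParRed.exists_of_body {κ : Kind} {e : Expr κ} {φ : Multiset (Expr κ)} (h : ParRed e φ) :
    ∀ s, e.body = some s → ∃ σ, ParRed s σ ∧ HEq φ (lamSum σ) := by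
  induction h with
  | var n => intro s hs; cases hs
  | redex _ _ _ _ => intro s hs; simp at hs
  | lam h _ => intro s hs; simp at hs; subst hs; exact ⟨_, h, HEq.rfl⟩
  | app _ _ _ _ => intro s hs; simp at hs
  | nil => intro s hs; cases hs
  | @cons s t _ _ _ _ _ _ =>
    intro r hs
    obtain ⟨s, rfl⟩ := s.mk_surj
    obtain ⟨t, rfl⟩ := t.mk_surj
    cases hs

theorem ParRed.exists_of_lam {s : Expr Kind.tm} {φ : Multiset (Expr Kind.tm)}
    (h : ParRed (Expr.lam s) φ) : ∃ σ, ParRed s σ ∧ φ = lamSum σ := by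
  obtain ⟨σ, h₁, h₂⟩ := h.exists_of_body s (Expr.body_lam s)
  exact ⟨σ, h₁, eq_of_heq h₂⟩

theorem SumRed.exists_of_lam {σ φ ψ : Multiset (Expr Kind.tm)} (h : SumRed φ ψ) :
    φ = lamSum σ → ∃ ρ, ψ = lamSum ρ ∧ SumRed σ ρ := by
  induction h generalizing σ with
  | zero =>
    intro h
    obtain rfl : σ = 0 := by simpa [lamSum, eq_comm] using h
    exact ⟨0, rfl, SumRed.zero⟩
  | @cons e φ τ τ' he _ ih =>
    intro h
    have hmem : e ∈ lamSum σ := h ▸ Multiset.mem_cons_self e τ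
    obtain ⟨s, hs, rfl⟩ := mem_lamSum.1 hmem
    obtain ⟨σ, rfl⟩ := Multiset.exists_cons_of_mem hs
    rw [lamSum, Multiset.map_cons, Multiset.cons_inj_right] at h
    obtain ⟨ρ, rfl, hρ⟩ := ih h
    obtain ⟨α, hα, rfl⟩ := he.exists_of_lam
    exact ⟨α + ρ, (Multiset.map_add ..).symm, SumRed.cons hα hρ⟩

/-- The triangle property: redexes already fired are dealt with by `SumRed.lsubst`, and those left
aside are fired now. -/
theorem ParRed.sumRed_fullReduct {κ : Kind} {e : Expr κ} {φ : Multiset (Expr κ)}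
    (h : ParRed e φ) : SumRed φ e.fullReduct := by
  induction h with
  | var n => exact SumRed.single (ParRed.var n)
  | redex _ _ ih₁ ih₂ => rw [Expr.fullReduct_redex]; exact ih₁.lsubst ih₂
  | lam _ ih => rw [Expr.fullReduct_lam]; exact ih.lam
  | @app s t σ τ h _ ih₁ ih₂ =>
    by_cases hs : ∃ r, s = Expr.lam r
    · obtain ⟨r, rfl⟩ := hs
      -- The redex was reduced inside but not fired. Abstractions reduce only to sums of
      -- abstractions, so all its residuals are still redexes.
      obtain ⟨ρ, hρ, rfl⟩ := h.exists_of_lam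
      obtain ⟨ρ', h₁, h₂⟩ := ih₁.exists_of_lam rfl
      rw [Expr.fullReduct_lam] at h₁
      rw [Expr.fullReduct_redex, Multiset.map_injective Expr.lam_injective h₁]
      exact h₂.redex ih₂
    · rw [Expr.fullReduct_app s t (not_exists.1 hs)]
      exact ih₁.app ih₂
  | nil => exact SumRed.single ParRed.nil
  | cons _ _ ih₁ ih₂ => rw [Expr.fullReduct_cons]; exact ih₁.mon_cons ih₂

theorem Expr.parRed_fullReduct {κ : Kind} (e : Expr κ) : ParRed e e.fullReduct := by
  induction e using Expr.ind with
  | var n => exact ParRed.var n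
  | lam s ih => rw [fullReduct_lam]; exact ih.lam
  | app s t ih₁ ih₂ =>
    by_cases hs : ∃ r, s = Expr.lam r
    · obtain ⟨r, rfl⟩ := hs
      obtain ⟨ρ, hρ, h⟩ := ih₁.exists_of_lam
      rw [fullReduct_lam] at h
      rw [fullReduct_redex, Multiset.map_injective Expr.lam_injective h]
      exact hρ.redex ih₂
    · rw [fullReduct_app s t (not_exists.1 hs)]
      exact ih₁.app ih₂
  | nil => exact ParRed.nil
  | cons s t ih₁ ih₂ => rw [fullReduct_cons]; exact ih₁.cons ih₂

/-! ### Size, height and free variables of reducts -/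

/-- The number of variables, abstractions and applications of a raw expression. -/
def Raw.size : {κ : Kind} → Raw κ → ℕ
  | _, Raw.var _ => 1
  | _, Raw.lam s => 1 + s.size
  | _, Raw.app s t => 1 + s.size + t.size
  | _, Raw.nil => 0
  | _, Raw.cons s t => s.size + t.size

theorem Raw.size_congr {κ : Kind} {e f : Raw κ} (h : Raw.Equiv e f) : e.size = f.size := by
  induction h with
  | refl e => rfl
  | symm _ ih => exact ih.symm
  | trans _ _ ih₁ ih₂ => exact ih₁.trans ih₂
  | lam _ ih => simp [Raw.size, ih]
  | app _ _ ih₁ ih₂ => simp [Raw.size, ih₁, ih₂]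
  | cons _ _ ih₁ ih₂ => simp [Raw.size, ih₁, ih₂]
  | swap a b t => simp [Raw.size, add_left_comm]

/-- The size of an expression. -/
def Expr.size {κ : Kind} (e : Expr κ) : ℕ :=
  Quotient.liftOn e Raw.size fun _ _ h => Raw.size_congr h

@[simp] theorem Expr.size_var (n : ℕ) : (Expr.var n).size = 1 := rfl

@[simp] theorem Expr.size_lam (s : Expr Kind.tm) : (Expr.lam s).size = 1 + s.size := by
  obtain ⟨s, rfl⟩ := s.mk_surj
  rfl

@[simp] theorem Expr.size_app (s : Expr Kind.tm) (t : Expr Kind.mon) :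
    (Expr.app s t).size = 1 + s.size + t.size := by
  obtain ⟨s, rfl⟩ := s.mk_surj
  obtain ⟨t, rfl⟩ := t.mk_surj
  rfl

@[simp] theorem Expr.size_nil : Expr.nil.size = 0 := rfl

@[simp] theorem Expr.size_cons (s : Expr Kind.tm) (t : Expr Kind.mon) :
    (Expr.cons s t).size = s.size + t.size := by
  obtain ⟨s, rfl⟩ := s.mk_surj
  obtain ⟨t, rfl⟩ := t.mk_surj
  rfl

theorem Expr.tm_cases {motive : Expr Kind.tm → Prop} (var : ∀ n, motive (Expr.var n))
    (lam : ∀ s, motive (Expr.lam s)) (app : ∀ s t, motive (Expr.app s t)) (s : Expr Kind.tm) :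
    motive s := by
  obtain ⟨s, rfl⟩ := s.mk_surj
  cases s with
  | var n => exact var n
  | lam s => exact lam (Expr.mk s)
  | app s t => exact app (Expr.mk s) (Expr.mk t)

theorem Expr.size_pos (s : Expr Kind.tm) : 1 ≤ s.size := by
  induction s using Expr.tm_cases with
  | var n => simp
  | lam s => simp
  | app s t => rw [size_app]; omega

theorem Expr.size_rename {κ : Kind} (e : Expr κ) : ∀ f : ℕ → ℕ, (e.rename f).size = e.size := by
  induction e using Expr.ind with
  | var n => intro f; rfl
  | lam s ih => intro f; simp [ih]
  | app s t ih₁ ih₂ => intro f; simp [ih₁, ih₂]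
  | nil => intro f; rfl
  | cons s t ih₁ ih₂ => intro f; simp [ih₁, ih₂]

theorem Expr.height_rename {κ : Kind} (e : Expr κ) :
    ∀ f : ℕ → ℕ, (e.rename f).height = e.height := by
  induction e using Expr.ind with
  | var n => intro f; rfl
  | lam s ih => intro f; simp [ih]
  | app s t ih₁ ih₂ => intro f; simp [ih₁, ih₂]
  | nil => intro f; rfl
  | cons s t ih₁ ih₂ => intro f; simp [ih₁, ih₂]

theorem Expr.sum_size_elems (t : Expr Kind.mon) : (t.elems.map Expr.size).sum = t.size := by
  induction t using Expr.mon_ind with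
  | nil => rfl
  | cons s t ih => simp [ih]

theorem Expr.height_le_of_mem_elems (t : Expr Kind.mon) : ∀ u ∈ t.elems, u.height ≤ t.height := by
  induction t using Expr.mon_ind with
  | nil => simp
  | cons s t ih =>
    intro u hu
    rw [elems_cons, Multiset.mem_cons] at hu
    rw [height_cons]
    rcases hu with rfl | hu
    · exact le_max_left _ _
    · exact (ih u hu).trans (le_max_right _ _)

theorem Expr.fv_subset_of_mem_elems (t : Expr Kind.mon) : ∀ u ∈ t.elems, u.fv ⊆ t.fv := by
  induction t using Expr.mon_ind with
  | nil => simp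
  | cons s t ih =>
    intro u hu
    rw [elems_cons, Multiset.mem_cons] at hu
    rw [fv_cons]
    rcases hu with rfl | hu
    · exact Set.subset_union_left
    · exact (ih u hu).trans Set.subset_union_right

theorem Expr.mem_linSubst_var {f : ℕ → Option ℕ} {n : ℕ} {m : Multiset (Expr Kind.tm)}
    {e' : Expr Kind.tm} (h : e' ∈ (Expr.var n).linSubst f m) :
    (f n = none ∧ m = {e'}) ∨ ∃ k, f n = some k ∧ m = 0 ∧ e' = Expr.var k := by
  cases hf : f n with
  | none =>
    rw [linSubst_var_none hf] at h
    split_ifs at h with hm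
    · obtain ⟨u, rfl⟩ := Multiset.card_eq_one.1 hm
      rw [Multiset.mem_singleton.1 h]
      exact Or.inl ⟨rfl, rfl⟩
    · simp at h
  | some k =>
    rw [linSubst_var_some hf] at h
    split_ifs at h with hm
    · exact Or.inr ⟨k, rfl, hm, Multiset.mem_singleton.1 h⟩
    · simp at h

theorem Expr.mem_linSubst_nil {f : ℕ → Option ℕ} {m : Multiset (Expr Kind.tm)}
    {e' : Expr Kind.mon} (h : e' ∈ Expr.nil.linSubst f m) : m = 0 ∧ e' = Expr.nil := by
  rw [linSubst_nil] at h
  split_ifs at h with hm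
  · exact ⟨hm, Multiset.mem_singleton.1 h⟩
  · simp at h

theorem Expr.mem_linSubst_lam {f : ℕ → Option ℕ} {m : Multiset (Expr Kind.tm)}
    {s e' : Expr Kind.tm} (h : e' ∈ (Expr.lam s).linSubst f m) :
    ∃ s' ∈ s.linSubst (liftLin f) (m.map Expr.shift), Expr.lam s' = e' := by
  rw [linSubst_lam] at h
  exact mem_lamSum.1 h

theorem Expr.mem_linSubst_app {f : ℕ → Option ℕ} {m : Multiset (Expr Kind.tm)}
    {s e' : Expr Kind.tm} {t : Expr Kind.mon} (h : e' ∈ (Expr.app s t).linSubst f m) :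
    ∃ x y, x + y = m ∧ ∃ s' ∈ s.linSubst f x, ∃ t' ∈ t.linSubst f y, Expr.app s' t' = e' := by
  rw [linSubst_app, mem_split] at h
  obtain ⟨x, y, hm, h⟩ := h
  exact ⟨x, y, hm, mem_appSum.1 h⟩

theorem Expr.mem_linSubst_cons {f : ℕ → Option ℕ} {m : Multiset (Expr Kind.tm)}
    {s : Expr Kind.tm} {t e' : Expr Kind.mon} (h : e' ∈ (Expr.cons s t).linSubst f m) :
    ∃ x y, x + y = m ∧ ∃ s' ∈ s.linSubst f x, ∃ t' ∈ t.linSubst f y, Expr.cons s' t' = e' := by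
  rw [linSubst_cons, mem_split] at h
  obtain ⟨x, y, hm, h⟩ := h
  exact ⟨x, y, hm, mem_consSum.1 h⟩

/-- Linearity at work: every resource is used, and it replaces a variable of size 1 by a term of
size at least 1. Neither `e` nor `m` can lose size. -/
theorem Expr.size_le_of_mem_linSubst {κ : Kind} (e : Expr κ) :
    ∀ (f : ℕ → Option ℕ) (m : Multiset (Expr Kind.tm)), ∀ e' ∈ e.linSubst f m,
      e.size ≤ e'.size ∧ (m.map Expr.size).sum ≤ e'.size := by
  induction e using Expr.ind with
  | var n =>
    intro f m e' h
    rcases mem_linSubst_var h with ⟨-, rfl⟩ | ⟨k, -, rfl, rfl⟩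
    · simp [size_pos]
    · simp
  | lam s ih =>
    intro f m e' h
    obtain ⟨s', hs', rfl⟩ := mem_linSubst_lam h
    have := ih _ _ s' hs'
    simp only [Multiset.map_map, Function.comp_def, shift, size_rename] at this
    change _ ∧ (m.map Expr.size).sum ≤ _ at this
    rw [size_lam, size_lam]
    omega
  | app s t ih₁ ih₂ =>
    intro f m e' h
    obtain ⟨x, y, rfl, s', hs', t', ht', rfl⟩ := mem_linSubst_app h
    have h₁ := ih₁ _ _ s' hs'
    have h₂ := ih₂ _ _ t' ht'
    rw [size_app, size_app, Multiset.map_add, Multiset.sum_add]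
    omega
  | nil =>
    intro f m e' h
    obtain ⟨rfl, rfl⟩ := mem_linSubst_nil h
    simp
  | cons s t ih₁ ih₂ =>
    intro f m e' h
    obtain ⟨x, y, rfl, s', hs', t', ht', rfl⟩ := mem_linSubst_cons h
    have h₁ := ih₁ _ _ s' hs'
    have h₂ := ih₂ _ _ t' ht'
    rw [size_cons, size_cons, Multiset.map_add, Multiset.sum_add]
    omega

/-- Resources only replace occurrences of variables, so heights at most add up. -/
theorem Expr.height_le_of_mem_linSubst {κ : Kind} (N : ℕ) (e : Expr κ) :
    ∀ (f : ℕ → Option ℕ) (m : Multiset (Expr Kind.tm)), (∀ u ∈ m, u.height ≤ N) →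
      ∀ e' ∈ e.linSubst f m, e'.height ≤ e.height + N := by
  induction e using Expr.ind with
  | var n =>
    intro f m hm e' h
    rcases mem_linSubst_var h with ⟨-, rfl⟩ | ⟨k, -, rfl, rfl⟩
    · exact (hm e' (Multiset.mem_singleton_self e')).trans (Nat.le_add_left _ _)
    · simp
  | lam s ih =>
    intro f m hm e' h
    obtain ⟨s', hs', rfl⟩ := mem_linSubst_lam h
    have := ih _ _ (by simpa [shift, height_rename] using hm) s' hs'
    rw [height_lam, height_lam]
    omega
  | app s t ih₁ ih₂ =>
    intro f m hm e' h
    obtain ⟨x, y, rfl, s', hs', t', ht', rfl⟩ := mem_linSubst_app h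
    have h₁ := ih₁ _ _ (fun u hu => hm u (Multiset.mem_add.2 (Or.inl hu))) s' hs'
    have h₂ := ih₂ _ _ (fun u hu => hm u (Multiset.mem_add.2 (Or.inr hu))) t' ht'
    rw [height_app, height_app]
    omega
  | nil =>
    intro f m hm e' h
    obtain ⟨rfl, rfl⟩ := mem_linSubst_nil h
    simp
  | cons s t ih₁ ih₂ =>
    intro f m hm e' h
    obtain ⟨x, y, rfl, s', hs', t', ht', rfl⟩ := mem_linSubst_cons h
    have h₁ := ih₁ _ _ (fun u hu => hm u (Multiset.mem_add.2 (Or.inl hu))) s' hs'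
    have h₂ := ih₂ _ _ (fun u hu => hm u (Multiset.mem_add.2 (Or.inr hu))) t' ht'
    rw [height_cons, height_cons]
    omega

theorem Expr.fv_subset_of_mem_linSubst {κ : Kind} (e : Expr κ) :
    ∀ (f : ℕ → Option ℕ) (m : Multiset (Expr Kind.tm)) (A : Set ℕ),
      (∀ j ∈ e.fv, ∀ n, f j = some n → n ∈ A) → (∀ u ∈ m, u.fv ⊆ A) →
      ∀ e' ∈ e.linSubst f m, e'.fv ⊆ A := by
  induction e using Expr.ind with
  | var n =>
    intro f m A hf hm e' h
    rcases mem_linSubst_var h with ⟨-, rfl⟩ | ⟨k, hk, rfl, rfl⟩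
    · exact hm e' (Multiset.mem_singleton_self e')
    · simpa using hf n rfl k hk
  | lam s ih =>
    intro f m A hf hm e' h
    obtain ⟨s', hs', rfl⟩ := mem_linSubst_lam h
    -- The set `A` moved under the binder: it contains the bound variable `0` and the successors of
    -- the elements of `A`.
    have := ih (liftLin f) _ {n | ∀ k, n = k + 1 → k ∈ A} ?_ ?_ s' hs'
    · rw [fv_lam]
      exact fun n hn => this hn n rfl
    · rintro j hj n hn k rfl
      cases j with
      | zero => simp [liftLin] at hn
      | succ j => exact hf j (by simpa using hj) k (by simpa [liftLin] using hn)
    · intro u hu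
      obtain ⟨v, hv, rfl⟩ := Multiset.mem_map.1 hu
      rw [fv_shift]
      rintro _ ⟨n, hn, rfl⟩ k hk
      obtain rfl : n = k := Nat.succ.inj hk
      exact hm v hv hn
  | app s t ih₁ ih₂ =>
    intro f m A hf hm e' h
    obtain ⟨x, y, rfl, s', hs', t', ht', rfl⟩ := mem_linSubst_app h
    rw [fv_app] at hf ⊢
    exact Set.union_subset
      (ih₁ f x A (fun j hj => hf j (Or.inl hj))
        (fun u hu => hm u (Multiset.mem_add.2 (Or.inl hu))) s' hs')
      (ih₂ f y A (fun j hj => hf j (Or.inr hj))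
        (fun u hu => hm u (Multiset.mem_add.2 (Or.inr hu))) t' ht')
  | nil =>
    intro f m A hf hm e' h
    obtain ⟨rfl, rfl⟩ := mem_linSubst_nil h
    simp
  | cons s t ih₁ ih₂ =>
    intro f m A hf hm e' h
    obtain ⟨x, y, rfl, s', hs', t', ht', rfl⟩ := mem_linSubst_cons h
    rw [fv_cons] at hf ⊢
    exact Set.union_subset
      (ih₁ f x A (fun j hj => hf j (Or.inl hj))
        (fun u hu => hm u (Multiset.mem_add.2 (Or.inl hu))) s' hs')
      (ih₂ f y A (fun j hj => hf j (Or.inr hj))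
        (fun u hu => hm u (Multiset.mem_add.2 (Or.inr hu))) t' ht')

theorem Expr.size_le_of_mem_lsubst {κ : Kind} {e e' : Expr κ} {t : Expr Kind.mon}
    (h : e' ∈ e.lsubst t) : e.size ≤ e'.size ∧ t.size ≤ e'.size := by
  rw [lsubst_eq] at h
  simpa [sum_size_elems] using size_le_of_mem_linSubst e _ _ e' h

theorem Expr.height_le_of_mem_lsubst {κ : Kind} {e e' : Expr κ} {t : Expr Kind.mon}
    (h : e' ∈ e.lsubst t) : e'.height ≤ e.height + t.height := by
  rw [lsubst_eq] at h
  exact height_le_of_mem_linSubst _ e _ _ t.height_le_of_mem_elems e' h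

theorem Expr.fv_subset_of_mem_lsubst {κ : Kind} {e e' : Expr κ} {t : Expr Kind.mon}
    (h : e' ∈ e.lsubst t) : e'.fv ⊆ {n | n + 1 ∈ e.fv} ∪ t.fv := by
  rw [lsubst_eq] at h
  refine fv_subset_of_mem_linSubst e _ _ _ ?_
    (fun u hu => (t.fv_subset_of_mem_elems u hu).trans Set.subset_union_right) e' h
  intro j hj n hn
  cases j with
  | zero => simp [linZero] at hn
  | succ j =>
    obtain rfl : j = n := by simpa [linZero] using hn
    exact Or.inl hj

/-- Firing a redex loses two nodes, and body and arguments are each bounded only by the same reduct.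
With N the larger of their heights, this gives at most 2 + 2 · 4 ^ N · `e'.size`, which is at most 4
^ (N + 1) · `e'.size`; the redex itself has height N + 1. -/
theorem ParRed.size_le {κ : Kind} {e : Expr κ} {φ : Multiset (Expr κ)} (h : ParRed e φ) :
    ∀ e' ∈ φ, e.size ≤ 4 ^ e.height * e'.size := by
  have mono {a b c d : ℕ} (h : a ≤ 4 ^ b * c) (hb : b ≤ d) : a ≤ 4 ^ d * c :=
    h.trans (Nat.mul_le_mul_right c (Nat.pow_le_pow_right (by norm_num) hb))
  induction h with
  | var n => simp
  | @redex s t σ τ _ _ ih₁ ih₂ =>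
    intro e' h
    obtain ⟨s', hs', t', ht', h⟩ := mem_lsubstSum.1 h
    have hl := Expr.size_le_of_mem_lsubst h
    have hpos := e'.size_pos
    set N := max s.height t.height with hN
    have h₁ := (mono (ih₁ s' hs') (le_max_left _ t.height)).trans (Nat.mul_le_mul_left _ hl.1)
    have h₂ := (mono (ih₂ t' ht') (le_max_right s.height _)).trans (Nat.mul_le_mul_left _ hl.2)
    have h₃ : 1 ≤ 4 ^ N * e'.size := Nat.mul_pos (by positivity) hpos
    have hh : (Expr.app (Expr.lam s) t).height = N + 1 := by
      rw [Expr.height_app, Expr.height_lam]; omega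
    rw [hh, pow_succ, Expr.size_app, Expr.size_lam]
    rw [← hN] at h₁ h₂
    rw [mul_comm (4 ^ N), mul_assoc]
    omega
  | @lam s σ _ ih =>
    intro e' h
    obtain ⟨s', hs', rfl⟩ := mem_lamSum.1 h
    have h₁ := mono (ih s' hs') (Nat.le_add_left s.height 1)
    have h₂ : 1 ≤ 4 ^ (1 + s.height) := Nat.one_le_pow _ _ (by norm_num)
    rw [Expr.size_lam, Expr.size_lam, Expr.height_lam, mul_add]
    omega
  | @app s t σ τ _ _ ih₁ ih₂ =>
    intro e' h
    obtain ⟨s', hs', t', ht', rfl⟩ := mem_appSum.1 h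
    rw [Expr.size_app, Expr.size_app, Expr.height_app, mul_add, mul_add]
    set N := max s.height (1 + t.height) with hN
    have h₁ := mono (d := N) (ih₁ s' hs') (by omega)
    have h₂ := mono (d := N) (ih₂ t' ht') (by omega)
    have h₃ : 1 ≤ 4 ^ N := Nat.one_le_pow _ _ (by norm_num)
    omega
  | nil => simp
  | @cons s t σ τ _ _ ih₁ ih₂ =>
    intro e' h
    obtain ⟨s', hs', t', ht', rfl⟩ := mem_consSum.1 h
    rw [Expr.size_cons, Expr.size_cons, Expr.height_cons, mul_add]
    exact add_le_add (mono (ih₁ s' hs') (le_max_left _ _)) (mono (ih₂ t' ht') (le_max_right _ _))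

/-- Firing a redex adds the heights of body and arguments, which at most doubles the bound, while
the redex is one higher than either. -/
theorem ParRed.height_le {κ : Kind} {e : Expr κ} {φ : Multiset (Expr κ)} (h : ParRed e φ) :
    ∀ e' ∈ φ, e'.height ≤ 2 ^ e.height := by
  have mono {a b d : ℕ} (h : a ≤ 2 ^ b) (hb : b ≤ d) : a ≤ 2 ^ d :=
    h.trans (Nat.pow_le_pow_right (by norm_num) hb)
  induction h with
  | var n => simp
  | @redex s t σ τ _ _ ih₁ ih₂ =>
    intro e' h
    obtain ⟨s', hs', t', ht', h⟩ := mem_lsubstSum.1 h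
    have hl := Expr.height_le_of_mem_lsubst h
    have h₁ := mono (ih₁ s' hs') (le_max_left _ t.height)
    have h₂ := mono (ih₂ t' ht') (le_max_right s.height _)
    have hh : (Expr.app (Expr.lam s) t).height = max s.height t.height + 1 := by
      rw [Expr.height_app, Expr.height_lam]; omega
    rw [hh, pow_succ]
    omega
  | @lam s σ _ ih =>
    intro e' h
    obtain ⟨s', hs', rfl⟩ := mem_lamSum.1 h
    have h₁ := ih s' hs'
    have h₂ : 1 ≤ 2 ^ s.height := Nat.one_le_pow _ _ (by norm_num)
    rw [Expr.height_lam, Expr.height_lam, add_comm 1 s.height, pow_succ]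
    omega
  | @app s t σ τ _ _ ih₁ ih₂ =>
    intro e' h
    obtain ⟨s', hs', t', ht', rfl⟩ := mem_appSum.1 h
    have h₁ := ih₁ s' hs'
    have h₂ := ih₂ t' ht'
    have h₃ : 1 ≤ 2 ^ t.height := Nat.one_le_pow _ _ (by norm_num)
    have h₄ : 1 + t'.height ≤ 2 ^ (1 + t.height) := by
      rw [add_comm 1 t.height, pow_succ]; omega
    rw [Expr.height_app, Expr.height_app]
    exact max_le (mono h₁ (le_max_left _ _)) (mono h₄ (le_max_right _ _))
  | nil => simp
  | @cons s t σ τ _ _ ih₁ ih₂ =>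
    intro e' h
    obtain ⟨s', hs', t', ht', rfl⟩ := mem_consSum.1 h
    rw [Expr.height_cons, Expr.height_cons]
    exact max_le (mono (ih₁ s' hs') (le_max_left _ _)) (mono (ih₂ t' ht') (le_max_right _ _))

theorem ParRed.fv_subset {κ : Kind} {e : Expr κ} {φ : Multiset (Expr κ)} (h : ParRed e φ) :
    ∀ e' ∈ φ, e'.fv ⊆ e.fv := by
  induction h with
  | var n => simp
  | @redex s t σ τ _ _ ih₁ ih₂ =>
    intro e' h
    obtain ⟨s', hs', t', ht', h⟩ := mem_lsubstSum.1 h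
    rw [Expr.fv_app, Expr.fv_lam]
    exact (Expr.fv_subset_of_mem_lsubst h).trans
      (Set.union_subset_union (fun n hn => ih₁ s' hs' hn) (ih₂ t' ht'))
  | lam _ ih =>
    intro e' h
    obtain ⟨s', hs', rfl⟩ := mem_lamSum.1 h
    rw [Expr.fv_lam, Expr.fv_lam]
    exact fun n hn => ih s' hs' hn
  | app _ _ ih₁ ih₂ =>
    intro e' h
    obtain ⟨s', hs', t', ht', rfl⟩ := mem_appSum.1 h
    rw [Expr.fv_app, Expr.fv_app]
    exact Set.union_subset_union (ih₁ s' hs') (ih₂ t' ht')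
  | nil => simp
  | cons _ _ ih₁ ih₂ =>
    intro e' h
    obtain ⟨s', hs', t', ht', rfl⟩ := mem_consSum.1 h
    rw [Expr.fv_cons, Expr.fv_cons]
    exact Set.union_subset_union (ih₁ s' hs') (ih₂ t' ht')

/-! ### Finiteness of antecedents -/

theorem finite_tm_mon_size_le (N : ℕ) :
    (∀ A : Set ℕ, A.Finite → {e : Expr Kind.tm | e.size ≤ N ∧ e.fv ⊆ A}.Finite) ∧
      ∀ A : Set ℕ, A.Finite → {e : Expr Kind.mon | e.size ≤ N ∧ e.fv ⊆ A}.Finite := by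
  -- A `cons` has no size of its own, so a head may use the whole of `N`; it has size at least 1,
  -- which leaves `N - 1` for the tail. The condition `N ≠ 0` makes the tail set empty when
  -- truncated subtraction would not decrease.
  have mon (N : ℕ) (htm : ∀ A : Set ℕ, A.Finite →
        {e : Expr Kind.tm | e.size ≤ N ∧ e.fv ⊆ A}.Finite)
      (hmon : ∀ A : Set ℕ, A.Finite →
        {e : Expr Kind.mon | e.size ≤ N - 1 ∧ e.fv ⊆ A ∧ N ≠ 0}.Finite) :
      ∀ A : Set ℕ, A.Finite → {e : Expr Kind.mon | e.size ≤ N ∧ e.fv ⊆ A}.Finite := by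
    intro A hA
    refine ((Set.finite_singleton Expr.nil).union
      (Set.Finite.image2 Expr.cons (htm A hA) (hmon A hA))).subset ?_
    rintro t ⟨h₁, h₂⟩
    induction t using Expr.mon_ind with
    | nil => exact Or.inl rfl
    | cons s t _ =>
      rw [Expr.size_cons] at h₁
      rw [Expr.fv_cons, Set.union_subset_iff] at h₂
      have := s.size_pos
      exact Or.inr ⟨s, ⟨by omega, h₂.1⟩, t, ⟨by omega, h₂.2, by omega⟩, rfl⟩
  induction N with
  | zero =>
    have htm (A : Set ℕ) : A.Finite → {e : Expr Kind.tm | e.size ≤ 0 ∧ e.fv ⊆ A}.Finite := by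
      intro _
      convert Set.finite_empty
      ext e
      have := e.size_pos
      simp only [Set.mem_ofPred_eq, Set.mem_empty_iff_false, iff_false]
      omega
    exact ⟨htm, mon 0 htm fun A _ => by simp⟩
  | succ N ih =>
    have htm (A : Set ℕ) (hA : A.Finite) :
        {e : Expr Kind.tm | e.size ≤ N + 1 ∧ e.fv ⊆ A}.Finite := by
      refine (((hA.image Expr.var).union ((ih.1 (insert 0 (Nat.succ '' A))
        ((hA.image _).insert 0)).image Expr.lam)).union
        (Set.Finite.image2 Expr.app (ih.1 A hA) (ih.2 A hA))).subset ?_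
      rintro e ⟨h₁, h₂⟩
      induction e using Expr.tm_cases with
      | var n => exact Or.inl (Or.inl ⟨n, h₂ rfl, rfl⟩)
      | lam s =>
        rw [Expr.size_lam] at h₁
        refine Or.inl (Or.inr ⟨s, ⟨by omega, ?_⟩, rfl⟩)
        intro n hn
        cases n with
        | zero => exact Or.inl rfl
        | succ n => exact Or.inr ⟨n, h₂ (by simpa using hn), rfl⟩
      | app s t =>
        rw [Expr.size_app] at h₁
        rw [Expr.fv_app, Set.union_subset_iff] at h₂
        exact Or.inr ⟨s, ⟨by omega, h₂.1⟩, t, ⟨by omega, h₂.2⟩, rfl⟩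
    exact ⟨htm, mon (N + 1) htm fun A hA => by simpa using ih.2 A hA⟩

theorem finite_size_le {κ : Kind} (N : ℕ) {A : Set ℕ} (hA : A.Finite) :
    {e : Expr κ | e.size ≤ N ∧ e.fv ⊆ A}.Finite := by
  cases κ with
  | tm => exact (finite_tm_mon_size_le N).1 A hA
  | mon => exact (finite_tm_mon_size_le N).2 A hA

theorem Expr.fv_subset_fvSet {κ : Kind} {e : Expr κ} {E : Set (Expr κ)} (h : e ∈ E) :
    e.fv ⊆ fvSet E := Set.subset_biUnion_of_mem (u := Expr.fv) h

theorem fvSet_mono {κ : Kind} {E F : Set (Expr κ)} (h : E ⊆ F) : fvSet E ⊆ fvSet F :=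
  Set.biUnion_subset_biUnion_left h

/-- Heights in `E` being at most some `H`, every antecedent of `x` has size at most 4 ^ H times that
of `x`, with free variables in a fixed finite set. All the summability claims come from here. -/
theorem finite_antecedents {κ : Kind} {E : Set (Expr κ)} (hE : E ∈ boundedStructure κ)
    (x : Expr κ) : {e | e ∈ E ∧ ∃ φ, ParRed e φ ∧ x ∈ φ}.Finite := by
  obtain ⟨H, hH⟩ := hE.1.bddAbove
  refine (finite_size_le (4 ^ H * x.size) hE.2).subset ?_
  rintro e ⟨he, φ, h, hx⟩
  refine ⟨(h.size_le x hx).trans (Nat.mul_le_mul_right _ ?_), Expr.fv_subset_fvSet he⟩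
  exact Nat.pow_le_pow_right (by norm_num) (hH ⟨e, he, rfl⟩)

/-- Parallel reduction is already reflexive, so the closure in `VecRedOn` adds nothing. -/
theorem parRed_of_reflClosure {κ : Kind} {e : Expr κ} {φ : Multiset (Expr κ)}
    (h : ReflClosure ParRed e φ) : ParRed e φ := by
  rcases h with h | rfl
  · exact h
  · exact ParRed.refl e

theorem isBoundedReductionStructure_boundedStructure (κ : Kind) :
    IsBoundedReductionStructure (boundedStructure κ) where
  left :=
    { finite_fv := fun _ hE => hE.2
      finite_mem := fun _ hE h => ⟨hE.image _, h⟩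
      union_mem := fun E hE F hF => by
        refine ⟨?_, ?_⟩
        · rw [Set.image_union]; exact hE.1.union hF.1
        · rw [fvSet, Set.biUnion_union]; exact hE.2.union hF.2
      subset_mem := fun _ hE _ hF => ⟨hE.1.subset (Set.image_mono hF), hE.2.subset (fvSet_mono hF)⟩
      reduct_mem := fun E hE => by
        obtain ⟨H, hH⟩ := hE.1.bddAbove
        refine ⟨(Set.finite_Iic (2 ^ H)).subset ?_, hE.2.subset ?_⟩
        · rintro _ ⟨e', ⟨e, he, φ, h, h'⟩, rfl⟩
          exact ((parRed_of_reflClosure h).height_le e' h').trans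
            (Nat.pow_le_pow_right (by norm_num) (hH ⟨e, he, rfl⟩))
        · refine Set.iUnion₂_subset ?_
          rintro e' ⟨e, he, φ, h, h'⟩
          exact ((parRed_of_reflClosure h).fv_subset e' h').trans (Expr.fv_subset_fvSet he) }
  right := subset_rfl

/-! ### Reduction of resource vectors -/

theorem SumRed.exists_fin {κ : Kind} {σ σ' : Multiset (Expr κ)} (h : SumRed σ σ') :
    ∃ (n : ℕ) (e : Fin n → Expr κ) (φ : Fin n → Multiset (Expr κ)),
      (∀ j, ParRed (e j) (φ j)) ∧ σ = ∑ j, {e j} ∧ σ' = ∑ j, φ j := by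
  induction h with
  | zero => exact ⟨0, Fin.elim0, Fin.elim0, fun j => j.elim0, by simp, by simp⟩
  | @cons e φ σ σ' h _ ih =>
    obtain ⟨n, f, ψ, hf, rfl, rfl⟩ := ih
    refine ⟨n + 1, Fin.cons e f, Fin.cons φ ψ, ?_, ?_, ?_⟩
    · intro j
      refine Fin.cases ?_ (fun j => ?_) j
      · simpa using h
      · simpa using hf j
    · simp [Fin.sum_univ_succ]
    · simp [Fin.sum_univ_succ]

section Vectors

variable {S : Type*} [CommSemiring S] {κ : Kind} {I : Type*}

theorem mem_of_toVec_ne_zero {σ : Multiset (Expr κ)} {x : Expr κ} (h : toVec S σ x ≠ 0) :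
    x ∈ σ := by
  classical
  by_contra hx
  exact h (by rw [toVec, Multiset.count_eq_zero_of_notMem hx, Nat.cast_zero])

open Classical in
theorem toVec_singleton (e x : Expr κ) : toVec S {e} x = if x = e then 1 else 0 := by
  rw [toVec, Multiset.count_singleton]
  split_ifs <;> simp

theorem toVec_sum {n : ℕ} (f : Fin n → Multiset (Expr κ)) (x : Expr κ) :
    toVec S (∑ j, f j) x = ∑ j, toVec S (f j) x := by
  simp only [toVec, Multiset.count_sum', Nat.cast_sum]

theorem exists_ne_zero_of_finsum_ne_zero {f : I → S} (h : ∑ᶠ i, f i ≠ 0) : ∃ i, f i ≠ 0 := by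
  by_contra! h'
  exact h (by simp [h'])

/-- As `finsum` is 0 on infinite supports, regrouping needs a finite set `K` of fibres outside which
everything vanishes. -/
theorem finsum_sigma_fin {n : I → ℕ} (g : (Σ i, Fin (n i)) → S) {K : Set I} (hK : K.Finite)
    (hg : ∀ p, g p ≠ 0 → p.1 ∈ K) : ∑ᶠ p, g p = ∑ᶠ i, ∑ j, g ⟨i, j⟩ := by
  rw [finsum_eq_sum_of_support_subset (s := hK.toFinset.sigma fun _ => Finset.univ) g,
    finsum_eq_sum_of_support_subset (s := hK.toFinset), Finset.sum_sigma]
  · intro i hi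
    obtain ⟨j, -, hj⟩ := Finset.exists_ne_zero_of_sum_ne_zero hi
    simpa using hg ⟨i, j⟩ hj
  · intro p hp
    simpa using hg p hp

/-- The coordinate at `x` equals 1 for all these indices; this is nonzero only if `S` is nontrivial.
-/
theorem finite_fibre [Nontrivial S] {e : I → Expr κ}
    (he : SummableFamily fun i => toVec S {e i}) (x : Expr κ) : {i | e i = x}.Finite := by
  refine (he x).subset fun i hi => ?_
  have : e i = x := hi
  simp [toVec_singleton, this]

/-- Reindexing of a linear combination of expressions. -/
theorem finsum_mul_comp [Nontrivial S] {e : I → Expr κ} (a : I → S)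
    (he : SummableFamily fun i => toVec S {e i}) (c : Expr κ → S) {Y : Set (Expr κ)}
    (hY : Y.Finite) (hc : ∀ i, c (e i) ≠ 0 → e i ∈ Y) :
    ∑ᶠ y, vecSum (fun i => a i • toVec S {e i}) y * c y = ∑ᶠ i, a i * c (e i) := by
  classical
  have hR : {i | e i ∈ Y}.Finite :=
    hY.preimage' fun y _ => finite_fibre he y
  have hv (y : Expr κ) : vecSum (fun i => a i • toVec S {e i}) y
      = ∑ᶠ i, if e i = y then a i else 0 := by
    refine finsum_congr fun i => ?_
    simp [toVec_singleton, eq_comm]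
  rw [finsum_eq_sum_of_support_subset (s := hR.toFinset) fun i => a i * c (e i),
    finsum_eq_sum_of_support_subset (s := hY.toFinset),
    ← Finset.sum_fiberwise_of_maps_to (g := e) (t := hY.toFinset) (s := hR.toFinset)
      (f := fun i => a i * c (e i)) fun i hi => by simpa using hi]
  · refine Finset.sum_congr rfl fun y hy => ?_
    rw [hv, finsum_eq_sum_of_support_subset (s := hR.toFinset), Finset.sum_mul,
      Finset.sum_filter]
    · refine Finset.sum_congr rfl fun i _ => ?_
      split_ifs with h
      · rw [h]
      · rw [zero_mul]
    · intro i hi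
      have : e i = y := by
        by_contra h
        exact hi (if_neg h)
      simpa [this] using hy
  · intro y hy
    have h₁ : vecSum (fun i => a i • toVec S {e i}) y ≠ 0 := left_ne_zero_of_mul hy
    rw [hv] at h₁
    obtain ⟨i, hi⟩ := exists_ne_zero_of_finsum_ne_zero h₁
    have h₂ : e i = y := by
      by_contra h
      exact hi (if_neg h)
    subst h₂
    simpa using hc i (right_ne_zero_of_mul hy)
  · intro i hi
    simpa using hc i (right_ne_zero_of_mul hi)

theorem vecFullReduct_apply (ε : Expr κ → S) (x : Expr κ) :
    vecFullReduct ε x = ∑ᶠ y, ε y * toVec S y.fullReduct x := by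
  change ∑ᶠ e : Function.support ε, ε e * toVec S (e : Expr κ).fullReduct x = _
  rw [finsum_set_coe_eq_finsum_mem (Function.support ε) (f := fun y =>
    ε y * toVec S y.fullReduct x), finsum_mem_def, Set.indicator_eq_self.2]
  exact fun y => left_ne_zero_of_mul

theorem VecRed.fullReduct {𝔈 : Set (Set (Expr κ))} (h𝔈 : IsBoundedReductionStructure 𝔈)
    {ε ε' : Expr κ → S} (h : VecRed ParRed 𝔈 ε ε') :
    IsBounded ε ∧
      SummableFamily (fun e : Function.support ε => toVec S (e : Expr κ).fullReduct) ∧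
      VecRed ParRed 𝔈 ε' (vecFullReduct ε) := by
  -- Over the zero semiring summability says nothing about the family `e`, but all vectors are
  -- equal.
  rcases subsingleton_or_nontrivial S with hS | hS
  · refine ⟨?_, fun x => ?_, ?_⟩
    · have : Function.support ε = ∅ :=
        Set.eq_empty_of_forall_notMem fun y hy => hy (Subsingleton.elim _ _)
      simp [IsBounded, this]
    · convert Set.finite_empty
      exact Set.eq_empty_of_forall_notMem fun i hi => hi (Subsingleton.elim _ _)
    · obtain rfl : ε = ε' := Subsingleton.elim _ _
      rwa [Subsingleton.elim (vecFullReduct ε) ε]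
  obtain ⟨E, hE, hε, hε', I, a, e, φ, he, rfl, -, rfl, hφ⟩ := h
  set ε := vecSum fun i => a i • toVec S {e i}
  have hb := h𝔈.2 hE
  have hsupp : Function.support ε ⊆ E := by
    intro y hy
    obtain ⟨i, hi⟩ := exists_ne_zero_of_finsum_ne_zero hy
    rw [Multiset.mem_singleton.1 (mem_of_toVec_ne_zero (right_ne_zero_of_mul hi))]
    exact (hφ i).1
  have hfin (x : Expr κ) : {i | ∃ ψ, ParRed (e i) ψ ∧ x ∈ ψ}.Finite :=
    ((finite_antecedents hb x).preimage' fun y _ => finite_fibre he y).subset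
      fun i hi => ⟨(hφ i).1, hi⟩
  -- The support of `ε` may miss some `e i`, and several indices may share an expression, so F(ε) is
  -- first rewritten as a sum over the given family.
  have hF (x : Expr κ) :
      vecFullReduct ε x = ∑ᶠ i, a i * toVec S (e i).fullReduct x := by
    rw [vecFullReduct_apply]
    exact finsum_mul_comp a he (fun y => toVec S y.fullReduct x) (finite_antecedents hb x)
      fun i hi => ⟨(hφ i).1, _, (e i).parRed_fullReduct, mem_of_toVec_ne_zero hi⟩
  set E' := {e' | ∃ e ∈ E, ∃ φ, ReflClosure ParRed e φ ∧ e' ∈ φ}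
  have hE'mem : E' ∈ 𝔈 := h𝔈.1.reduct_mem E hE
  -- The new family is indexed by pairs (i, j), where j runs over the summands of `φ i`; all of them
  -- keep the coefficient `a i`.
  choose n e' φ' hred hφe hφF using
    fun i => (parRed_of_reflClosure (hφ i).2).sumRed_fullReduct.exists_fin
  have hmem₁ (p : Σ i, Fin (n i)) : e' p.1 p.2 ∈ φ p.1 := by
    rw [hφe p.1, Multiset.mem_sum]
    exact ⟨p.2, Finset.mem_univ _, Multiset.mem_singleton_self _⟩
  have hmem₂ (p : Σ i, Fin (n i)) (x : Expr κ) (hx : x ∈ φ' p.1 p.2) :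
      x ∈ (e p.1).fullReduct := by
    rw [hφF p.1, Multiset.mem_sum]
    exact ⟨p.2, Finset.mem_univ _, hx⟩
  have hK₁ (x : Expr κ) (p : Σ i, Fin (n i)) (hp : toVec S {e' p.1 p.2} x ≠ 0) :
      p.1 ∈ {i | ∃ ψ, ParRed (e i) ψ ∧ x ∈ ψ} := by
    refine ⟨_, parRed_of_reflClosure (hφ p.1).2, ?_⟩
    rw [Multiset.mem_singleton.1 (mem_of_toVec_ne_zero hp)]
    exact hmem₁ p
  have hK₂ (x : Expr κ) (p : Σ i, Fin (n i)) (hp : toVec S (φ' p.1 p.2) x ≠ 0) :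
      p.1 ∈ {i | ∃ ψ, ParRed (e i) ψ ∧ x ∈ ψ} :=
    ⟨_, (e p.1).parRed_fullReduct, hmem₂ p x (mem_of_toVec_ne_zero hp)⟩
  have hsum {P : (Σ i, Fin (n i)) → Prop} {K : Set I} (hK : K.Finite) (h : ∀ p, P p → p.1 ∈ K) :
      {p | P p}.Finite :=
    (hK.toFinset.sigma fun _ => Finset.univ).finite_toSet.subset fun p hp => by
      simpa using h p hp
  refine ⟨hb.1.subset (Set.image_mono hsupp), fun x => ?_, E', hE'mem, hε', ?_, Σ i, Fin (n i),
    fun p => a p.1, fun p => e' p.1 p.2, fun p => φ' p.1 p.2, fun x => hsum (hfin x) (hK₁ x), ?_,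
    fun x => hsum (hfin x) (hK₂ x), ?_, fun p => ⟨⟨e p.1, (hφ p.1).1, φ p.1, (hφ p.1).2, hmem₁ p⟩,
      Or.inl (hred p.1 p.2)⟩⟩
  · refine Set.Finite.of_finite_image (f := Subtype.val)
      ((finite_antecedents hb x).subset ?_) Subtype.val_injective.injOn
    rintro _ ⟨y, hy, rfl⟩
    exact ⟨hsupp y.2, _, (y : Expr κ).parRed_fullReduct, mem_of_toVec_ne_zero hy⟩
  · refine (h𝔈.1.finite_fv E' hE'mem).subset (fvSet_mono fun x hx => ?_)
    have hx' : vecFullReduct ε x ≠ 0 := hx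
    rw [hF] at hx'
    obtain ⟨i, hi⟩ := exists_ne_zero_of_finsum_ne_zero hx'
    exact ⟨e i, (hφ i).1, _, Or.inl (e i).parRed_fullReduct,
      mem_of_toVec_ne_zero (right_ne_zero_of_mul hi)⟩
  · funext x
    change ∑ᶠ i, a i * toVec S (φ i) x = ∑ᶠ p : Σ i, Fin (n i), a p.1 * toVec S {e' p.1 p.2} x
    rw [finsum_sigma_fin _ (hfin x) fun p hp => hK₁ x p (right_ne_zero_of_mul hp)]
    refine finsum_congr fun i => ?_
    change _ = ∑ j, a i * toVec S {e' i j} x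
    rw [← Finset.mul_sum, ← toVec_sum, ← hφe]
  · funext x
    change _ = ∑ᶠ p : Σ i, Fin (n i), a p.1 * toVec S (φ' p.1 p.2) x
    rw [hF, finsum_sigma_fin _ (hfin x) fun p hp => hK₂ x p (right_ne_zero_of_mul hp)]
    refine finsum_congr fun i => ?_
    change _ = ∑ j, a i * toVec S (φ' i j) x
    rw [← Finset.mul_sum, ← toVec_sum, ← hφF]

end Vectors

end ResourceCalculus

theorem corollary5p22 {S : Type*} [CommSemiring S] (κ : Kind) :
    (∀ 𝔈 : Set (Set (Expr κ)), IsBoundedReductionStructure 𝔈 →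
      (∀ ε ε' : Expr κ → S, VecRed ParRed 𝔈 ε ε' →
        IsBounded ε ∧
        SummableFamily (fun e : Function.support ε => toVec S (e : Expr κ).fullReduct) ∧
        VecRed ParRed 𝔈 ε' (vecFullReduct ε)) ∧
      (∀ ε ε₁ ε₂ : Expr κ → S, VecRed ParRed 𝔈 ε ε₁ → VecRed ParRed 𝔈 ε ε₂ →
        ∃ ε'' : Expr κ → S, VecRed ParRed 𝔈 ε₁ ε'' ∧ VecRed ParRed 𝔈 ε₂ ε'')) ∧
    IsBoundedReductionStructure (boundedStructure κ) := by
  refine ⟨fun 𝔈 h𝔈 => ⟨fun _ _ h => h.fullReduct h𝔈, fun ε _ _ h₁ h₂ => ?_⟩,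
    isBoundedReductionStructure_boundedStructure κ⟩
  -- The full reduct does not depend on the reduction chosen from `ε`, so both sides meet there.
  exact ⟨vecFullReduct ε, (h₁.fullReduct h𝔈).2.2, (h₂.fullReduct h𝔈).2.2⟩
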